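/- Definitions. Write $e(x)=\exp(2\pi i x)$. Unitary matrices $S,T$ indexed by a finite set $\Phi$ are called modular data if $S$ is symmetric, $T$ is diagonal of finite order, $\left(\begin{smallmatrix}0&-1\\1&0\end{smallmatrix}\right)\mapsto S$, $\left(\begin{smallmatrix}1&1\\0&1\end{smallmatrix}\right)\mapsto T$ extends to a representation of $\mathrm{SL}_2(\mathbb Z)$, and some index $0\in\Phi$ is an identity: $S_{a,0}^2>0$ for all $a\in\Phi$, and $\sum_{d\in\Phi}S_{a,d}S_{b,d}S_{c,d}/S_{0,d}$ is a nonnegative integer for all $a,b,c\in\Phi$. A nondegenerate quadratic form on a finite abelian group $G$ is a map $Q:G\to\mathbb Q/\mathbb Z$ with $Q(-g)=Q(g)$ such that $\langle g,h\rangle_Q=e(Q(g+h)-Q(g)-Q(h))$ is a symmetric bicharacter whose characters $\langle g,\cdot\rangle_Q$, $g\in G$, are pairwise distinct. Its Gauss sums are $\alpha_Q(a)=|G|^{-1/2}\sum_{k\in G}e(aQ(k))$ for $a\in\mathbb Z$. **Proposition 7.** (a) Let $Q$ be a nondegenerate quadratic form on a finite abelian group $G$, let $\alpha,\beta\in\mathbb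 C$, and put $S^Q_{g,h}=\frac{\alpha}{\sqrt{|G|}}\overline{\langle g,h\rangle_Q}$ and $T^Q_{g,h}=\beta\,\delta_{g,h}\,e(Q(g))$ for $g,h\in G$. Then $S^Q,T^Q$ are modular data if and only if $\alpha=\pm1$ and $\beta^3=\alpha\,\alpha_Q(-1)$. In this case $0\in G$ is an identity, and it is the only identity $e$ for which all $S^Q_{g,e}/S^Q_{e,e}$ are positive. (b) Let $G,G'$ be abelian groups of odd orders $n$ and $n+4$, with nondegenerate quadratic forms $Q,Q'$. Write $\langle g,h\rangle=\langle g,h\rangle_Q^{(n+1)/2}$ on $G$ and $\langle\gamma,\gamma'\rangle'=\langle\gamma,\gamma'\rangle_{Q'}^{(n+5)/2}$ on $G'$. Let $\delta=\frac{n+\sqrt{n^2+4n}}2$ and $\lambda=n+\delta^2$. Let $\Phi$ consist of the following elements: $\mathfrak a_g$ ($g\in G$); $\mathfrak b_h$ ($h\in G$); $\mathfrak c_{k,l}=\mathfrak c_{l,k}$ ($k\ne l$ in $G$); and $\mathfrak d_{m,\gamma}=\mathfrak d_{m,-\gamma}$ ($m\in G$, $0\ne\gamma\in G'$). Then $|\Phi|=n(n+3)$.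 Let $T^{Q,Q'}$ be diagonal with entries $\langle g,g\rangle$ at $\mathfrak a_g$, $\langle h,h\rangle$ at $\mathfrak b_h$, $\langle k,l\rangle$ at $\mathfrak c_{k,l}$, and $\langle m,m\rangle\langle\gamma,\gamma\rangle'$ at $\mathfrak d_{m,\gamma}$. Let $S^{Q,Q'}$ be the matrix with block form (rows $\mathfrak a_g,\mathfrak b_h,\mathfrak c_{k,l},\mathfrak d_{m,\gamma}$, columns $\mathfrak a_{g'},\mathfrak b_{h'},\mathfrak c_{k',l'},\mathfrak d_{m',\gamma'}$) $$\frac1\lambda\begin{pmatrix} \overline{\langle g,g'\rangle}^2&(\delta+1)\overline{\langle g,h'\rangle}^2&(\delta+2)\overline{\langle g,k'+l'\rangle}&\delta\,\overline{\langle g,m'\rangle}^2\\ (\delta+1)\overline{\langle h,g'\rangle}^2&\overline{\langle h,h'\rangle}^2&(\delta+2)\overline{\langle h,k'+l'\rangle}&-\delta\,\overline{\langle h,m'\rangle}^2\\ (\delta+2)\overline{\langle k+l,g'\rangle}&(\delta+2)\overline{\langle k+l,h'\rangle}&(\delta+2)\left(\overline{\langle k,k'\rangle\langle l,l'\rangle}+\overline{\langle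 k,l'\rangle\langle l,k'\rangle}\right)&0\\ \delta\,\overline{\langle m,g'\rangle}^2&-\delta\,\overline{\langle m,h'\rangle}^2&0&-\delta\,\overline{\langle m,m'\rangle}^2\left(\langle\gamma,\gamma'\rangle'^2+\overline{\langle\gamma,\gamma'\rangle'}^2\right) \end{pmatrix}.$$ Then $S^{Q,Q'},T^{Q,Q'}$ are modular data if and only if $\alpha_Q(1)\,\alpha_{Q'}(1)=-1$. In this case $\mathfrak a_0$ is an identity, and it is the only identity $e$ for which all $S^{Q,Q'}_{x,e}/S^{Q,Q'}_{e,e}$ are positive. -/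

import Mathlib

noncomputable section

namespace NearGroup

/-! ### Modular data -/

/-- `e` may serve as the identity for `S`: the squares of the entries of the column of `e` are
positive reals, and the numbers given by Verlinde's formula are nonnegative integers. -/
structure IsIdentityFor {Φ : Type*} [Fintype Φ] (S : Matrix Φ Φ ℂ) (e : Φ) : Prop where
  sq_pos : ∀ a, ∃ r : ℝ, 0 < r ∧ S a e ^ 2 = (r : ℂ)
  verlinde : ∀ a b c, ∃ N : ℕ, ∑ d, S a d * S b d * S c d / S e d = (N : ℂ)

/-- Positivity of all quantum dimensions `S a e / S e e` relative to the index `e`. -/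
def HasPosDims {Φ : Type*} (S : Matrix Φ Φ ℂ) (e : Φ) : Prop :=
  ∀ a, ∃ r : ℝ, 0 < r ∧ S a e / S e e = (r : ℂ)

/-- Modular data: unitary matrices `S`, `T`, with `S` symmetric, `T` diagonal of finite order,
which are the images of `[[0, -1], [1, 0]]` and `[[1, 1], [0, 1]]` under a representation of
`SL(2, ℤ)`, and such that some index is an identity. -/
structure IsModularData {Φ : Type*} [Fintype Φ] [DecidableEq Φ] (S T : Matrix Φ Φ ℂ) : Prop where
  unitary_S : S ∈ Matrix.unitaryGroup Φ ℂ
  unitary_T : T ∈ Matrix.unitaryGroup Φ ℂ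
  symm_S : S.IsSymm
  diag_T : T.IsDiag
  finOrder_T : IsOfFinOrder T
  rep : ∃ ρ : Matrix.SpecialLinearGroup (Fin 2) ℤ →* Matrix Φ Φ ℂ,
    ρ ModularGroup.S = S ∧ ρ ModularGroup.T = T
  identity : ∃ e, IsIdentityFor S e

/-! ### Nondegenerate quadratic forms with values in `ℚ/ℤ` -/

/-- The character `q ↦ exp (2πi q)` of `ℚ/ℤ`. -/
def qzExp : AddCircle (1 : ℚ) → ℂ :=
  Function.Periodic.lift (f := fun q : ℚ => Complex.exp (2 * Real.pi * Complex.I * (q : ℂ)))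
    (c := 1) (by
      intro q
      simp only [Rat.cast_add, Rat.cast_one, mul_add, mul_one]
      exact Complex.exp_periodic _)

theorem qzExp_coe (q : ℚ) :
    qzExp (q : AddCircle (1 : ℚ)) = Complex.exp (2 * Real.pi * Complex.I * (q : ℂ)) := rfl

theorem conj_qzExp (x : AddCircle (1 : ℚ)) : (starRingEnd ℂ) (qzExp x) = (qzExp x)⁻¹ := by
  induction x using QuotientAddGroup.induction_on with
  | H q =>
    have h : qzExp (QuotientAddGroup.mk q : AddCircle (1 : ℚ))
        = Complex.exp (2 * Real.pi * Complex.I * (q : ℂ)) := rfl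
    rw [h, ← Complex.exp_conj, ← Complex.exp_neg]
    simp [map_ofNat]

/-- A pairing on `G`: a complex-valued function of two variables which is a character in each
of them. -/
def IsPairing {G : Type*} [AddCommGroup G] (p : G → G → ℂ) : Prop :=
  (∀ g, ∃ χ : AddChar G ℂ, ∀ h, p g h = χ h) ∧ (∀ h, ∃ χ : AddChar G ℂ, ∀ g, p g h = χ g)

/-- A nondegenerate symmetric pairing: the characters `p g` are pairwise distinct. -/
structure IsNondegSymmPairing {G : Type*} [AddCommGroup G] (p : G → G → ℂ) : Prop where
  pairing : IsPairing p
  symm : ∀ g h, p g h = p h g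
  nondeg : Function.Injective p

/-- A nondegenerate quadratic form `G → ℚ/ℤ`: an even map whose associated function
`⟨g, h⟩ = exp (2πi (Q (g + h) - Q g - Q h))` is a nondegenerate symmetric pairing. -/
structure NondegQuadForm (G : Type*) [AddCommGroup G] where
  toFun : G → AddCircle (1 : ℚ)
  even : ∀ g, toFun (-g) = toFun g
  nondeg : IsNondegSymmPairing fun g h => qzExp (toFun (g + h) - toFun g - toFun h)

namespace NondegQuadForm

variable {G : Type*} [AddCommGroup G] (Q : NondegQuadForm G)

/-- `⟨g, h⟩_Q = exp (2πi (Q (g + h) - Q g - Q h))`. -/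
def pairing (g h : G) : ℂ := qzExp (Q.toFun (g + h) - Q.toFun g - Q.toFun h)

/-- The normalized Gauss sum `α_Q(a) = |G|^{-1/2} ∑ exp (2πi a Q(k))`. -/
def gaussSum [Fintype G] (a : ℤ) : ℂ :=
  1 / (Real.sqrt (Fintype.card G) : ℂ) * ∑ k, qzExp (a • Q.toFun k)

/-- For `|G|` odd, the square root `⟨g, h⟩ = ⟨g, h⟩_Q ^ ((|G| + 1) / 2)` of `⟨g, h⟩_Q`. -/
def halfPairing [Fintype G] (g h : G) : ℂ := Q.pairing g h ^ ((Fintype.card G + 1) / 2)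

theorem pairing_comm (g h : G) : Q.pairing g h = Q.pairing h g := Q.nondeg.symm g h

theorem pairing_neg_left (g h : G) : Q.pairing (-g) h = (starRingEnd ℂ) (Q.pairing g h) := by
  obtain ⟨χ, hχ⟩ := Q.nondeg.pairing.2 h
  have h1 : ∀ g, Q.pairing g h = χ g := hχ
  have h2 : (starRingEnd ℂ) (Q.pairing g h) = (Q.pairing g h)⁻¹ := conj_qzExp _
  rw [h2, h1, h1, AddChar.map_neg_eq_inv]

variable [Fintype G]

theorem halfPairing_comm (g h : G) : Q.halfPairing g h = Q.halfPairing h g := by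
  rw [halfPairing, halfPairing, pairing_comm]

theorem halfPairing_neg_left (g h : G) :
    Q.halfPairing (-g) h = (starRingEnd ℂ) (Q.halfPairing g h) := by
  rw [halfPairing, halfPairing, pairing_neg_left, map_pow]

theorem halfPairing_neg_right (g h : G) :
    Q.halfPairing g (-h) = (starRingEnd ℂ) (Q.halfPairing g h) := by
  rw [halfPairing_comm, halfPairing_neg_left, halfPairing_comm]

/-- The combination `⟨g, h⟩² + conj ⟨g, h⟩²`, unchanged under `g ↦ -g` and under `h ↦ -h`. -/
def cosPairing (g h : G) : ℂ := Q.halfPairing g h ^ 2 + (starRingEnd ℂ) (Q.halfPairing g h) ^ 2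

theorem cosPairing_neg_left (g h : G) : Q.cosPairing (-g) h = Q.cosPairing g h := by
  simp only [cosPairing, halfPairing_neg_left, Complex.conj_conj, add_comm]

theorem cosPairing_neg_right (g h : G) : Q.cosPairing g (-h) = Q.cosPairing g h := by
  simp only [cosPairing, halfPairing_neg_right, Complex.conj_conj, add_comm]

theorem halfPairing_neg_neg (g : G) : Q.halfPairing (-g) (-g) = Q.halfPairing g g := by
  rw [halfPairing_neg_left, halfPairing_neg_right, Complex.conj_conj]

end NondegQuadForm

/-! ### The matrices attached to one quadratic form -/

section Weil

variable {G : Type*} [AddCommGroup G] [Fintype G] (Q : NondegQuadForm G)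

/-- `S_{g,h} = α |G|^{-1/2} conj ⟨g, h⟩_Q`. -/
def weilS (α : ℂ) : Matrix G G ℂ :=
  Matrix.of fun g h => α / (Real.sqrt (Fintype.card G) : ℂ) * (starRingEnd ℂ) (Q.pairing g h)

/-- `T_{g,h} = β δ_{g,h} exp (2πi Q(g))`. -/
def weilT [DecidableEq G] (β : ℂ) : Matrix G G ℂ :=
  Matrix.diagonal fun g => β * qzExp (Q.toFun g)

end Weil

/-! ### The matrices attached to two quadratic forms -/

/-- Nonzero elements of `G'` up to sign: `γ ∼ γ'` iff `γ = γ'` or `γ = -γ'`. -/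
def signSetoid (G' : Type*) [AddCommGroup G'] : Setoid {γ : G' // γ ≠ 0} where
  r x y := (x : G') = y ∨ (x : G') = -y
  iseqv :=
    { refl := fun _ => Or.inl rfl
      symm := by
        rintro x y (h | h)
        · exact Or.inl h.symm
        · exact Or.inr (by rw [h, neg_neg])
      trans := by
        rintro x y z (h | h) (k | k)
        · exact Or.inl (h.trans k)
        · exact Or.inr (h.trans k)
        · exact Or.inr (by rw [h, k])
        · exact Or.inl (by rw [h, k, neg_neg]) }

/-- The set of pairs `{γ, -γ}` with `0 ≠ γ ∈ G'`. -/
abbrev NonzeroUpToSign (G' : Type*) [AddCommGroup G'] : Type _ := Quotient (signSetoid G')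

instance signSetoidDecidable (G' : Type*) [AddCommGroup G'] [DecidableEq G'] :
    DecidableRel (signSetoid G').r :=
  fun x y => inferInstanceAs (Decidable ((x : G') = y ∨ (x : G') = -y))

instance nonzeroUpToSignDecidableEq (G' : Type*) [AddCommGroup G'] [DecidableEq G'] :
    DecidableEq (NonzeroUpToSign G') :=
  @Quotient.decidableEq _ (signSetoid G') (signSetoidDecidable G')

instance nonzeroUpToSignFintype (G' : Type*) [AddCommGroup G'] [Fintype G'] [DecidableEq G'] :
    Fintype (NonzeroUpToSign G') :=
  @Quotient.fintype _ _ (signSetoid G') (signSetoidDecidable G')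

/-- Unordered pairs `{k, l}` of distinct elements of `G`. -/
abbrev DistinctPair (G : Type*) : Type _ := {z : Sym2 G // ¬ z.IsDiag}

/-- The index set: `𝔞_g`, `𝔟_h` for `g, h ∈ G`, `𝔠_{k,l} = 𝔠_{l,k}` for distinct `k, l ∈ G`, and
`𝔡_{m,γ} = 𝔡_{m,-γ}` for `m ∈ G` and `0 ≠ γ ∈ G'`. -/
abbrev Primary (G G' : Type*) [AddCommGroup G'] : Type _ :=
  G ⊕ G ⊕ DistinctPair G ⊕ (G × NonzeroUpToSign G')

/-- The primary `𝔞_g`. -/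
abbrev Primary.a {G : Type*} (G' : Type*) [AddCommGroup G'] (g : G) : Primary G G' := Sum.inl g

/-- `δ = (n + √(n² + 4n)) / 2`. -/
def delta (n : ℕ) : ℝ := (n + Real.sqrt ((n : ℝ) ^ 2 + 4 * n)) / 2

/-- `λ = n + δ²`. -/
def lam (n : ℕ) : ℝ := n + delta n ^ 2

section TwoForms

variable {G G' : Type*} [AddCommGroup G] [Fintype G] [AddCommGroup G'] [Fintype G']
  (Q : NondegQuadForm G) (Q' : NondegQuadForm G')

/-- The sum `k + l` of an unordered pair `{k, l}`. -/
def pairSum (z : Sym2 G) : G := Sym2.lift ⟨fun k l => k + l, fun k l => add_comm k l⟩ z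

/-- `⟨k, l⟩` for an unordered pair `{k, l}`. -/
def pairTwist (z : Sym2 G) : ℂ :=
  Sym2.lift ⟨fun k l => Q.halfPairing k l, fun k l => Q.halfPairing_comm k l⟩ z

/-- `conj ⟨k, k'⟩ conj ⟨l, l'⟩ + conj ⟨k, l'⟩ conj ⟨l, k'⟩` for unordered pairs `{k, l}`,
`{k', l'}`. -/
def pairPair (z w : Sym2 G) : ℂ :=
  Sym2.lift₂ ⟨fun k l k' l' =>
      (starRingEnd ℂ) (Q.halfPairing k k') * (starRingEnd ℂ) (Q.halfPairing l l')
      + (starRingEnd ℂ) (Q.halfPairing k l') * (starRingEnd ℂ) (Q.halfPairing l k'),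
    by intro k l k' l'; constructor <;> ring⟩ z w

/-- `⟨γ, γ⟩'` for `γ` up to sign. -/
def signTwist (x : NonzeroUpToSign G') : ℂ :=
  Quotient.lift (s := signSetoid G') (fun γ => Q'.halfPairing (γ : G') γ) (by
    rintro x y (h | h)
    · simp only [h]
    · simp only [h, Q'.halfPairing_neg_neg]) x

/-- `⟨γ, γ'⟩'² + conj ⟨γ, γ'⟩'²` for `γ`, `γ'` up to sign. -/
def signCos (x y : NonzeroUpToSign G') : ℂ :=
  Quotient.lift₂ (s₁ := signSetoid G') (s₂ := signSetoid G')
    (fun γ γ' => Q'.cosPairing (γ : G') (γ' : G')) (by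
      rintro x y x' y' (h | h) (k | k) <;>
        simp only [h, k, Q'.cosPairing_neg_left, Q'.cosPairing_neg_right]) x y

/-- The entries of `λ S`, with `c g h = conj ⟨g, h⟩`. -/
def entryS : Primary G G' → Primary G G' → ℂ :=
  let δ : ℂ := (delta (Fintype.card G) : ℂ)
  let c : G → G → ℂ := fun g h => (starRingEnd ℂ) (Q.halfPairing g h)
  fun
  | .inl g, .inl g' => c g g' ^ 2
  | .inl g, .inr (.inl h') => (δ + 1) * c g h' ^ 2
  | .inl g, .inr (.inr (.inl z')) => (δ + 2) * c g (pairSum z'.1)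
  | .inl g, .inr (.inr (.inr (m', _))) => δ * c g m' ^ 2
  | .inr (.inl h), .inl g' => (δ + 1) * c h g' ^ 2
  | .inr (.inl h), .inr (.inl h') => c h h' ^ 2
  | .inr (.inl h), .inr (.inr (.inl z')) => (δ + 2) * c h (pairSum z'.1)
  | .inr (.inl h), .inr (.inr (.inr (m', _))) => -δ * c h m' ^ 2
  | .inr (.inr (.inl z)), .inl g' => (δ + 2) * c (pairSum z.1) g'
  | .inr (.inr (.inl z)), .inr (.inl h') => (δ + 2) * c (pairSum z.1) h'
  | .inr (.inr (.inl z)), .inr (.inr (.inl z')) => (δ + 2) * pairPair Q z.1 z'.1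
  | .inr (.inr (.inl _)), .inr (.inr (.inr _)) => 0
  | .inr (.inr (.inr (m, _))), .inl g' => δ * c m g' ^ 2
  | .inr (.inr (.inr (m, _))), .inr (.inl h') => -δ * c m h' ^ 2
  | .inr (.inr (.inr _)), .inr (.inr (.inl _)) => 0
  | .inr (.inr (.inr (m, x))), .inr (.inr (.inr (m', x'))) => -δ * c m m' ^ 2 * signCos Q' x x'

/-- The matrix `S^{Q,Q'}`. -/
def doubleS : Matrix (Primary G G') (Primary G G') ℂ :=
  Matrix.of fun x y => 1 / (lam (Fintype.card G) : ℂ) * entryS Q Q' x y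

/-- The diagonal entries of `T^{Q,Q'}`. -/
def entryT : Primary G G' → ℂ
  | .inl g => Q.halfPairing g g
  | .inr (.inl h) => Q.halfPairing h h
  | .inr (.inr (.inl z)) => pairTwist Q z.1
  | .inr (.inr (.inr (m, x))) => Q.halfPairing m m * signTwist Q' x

/-- The matrix `T^{Q,Q'}`. -/
def doubleT [DecidableEq G] [DecidableEq G'] : Matrix (Primary G G') (Primary G G') ℂ :=
  Matrix.diagonal (entryT Q Q')

end TwoForms

end NearGroup

end

/-! Matrices s, t come from a representation of SL(2, ℤ) exactly when s⁴ = 1 and (st)³ = s²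
(`exists_hom_iff`), so modularity comes down to two matrix identities. For one form, orthogonality
of characters gives S² = α²C with C the map g ↦ -g, and completing the square in STS gives (ST)³ =
αβ³α_Q(1)S² (`weil_cube`). Hence α⁴ = 1 and αβ³α_Q(1) = 1. Positivity at an identity leaves α = ±1,
and α_Q(1) has modulus 1, so β³ = α·α_Q(-1).

For two forms, oddness of |G| lets every pair {k, l} be written {m + p, m - p} with unique m and ±p.
The index set becomes G × `Neutral G G'`, and S, T split as Weil matrices of Q tensored with a core
(`doubleS_submatrix`, `doubleT_submatrix`). A vector v on `Neutral G G'` is the same as an even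
function on G together with an even function on G'. The classes of 𝔞 and 𝔟 supply the values v_𝔞 +
v_𝔟 and v_𝔟 - v_𝔞 at the two zeros. In these terms the core is the Weil pair of -Q with α = 1 and
that of Q' with α = -1. The normalizations match because √n(δ+2)/λ = 1/√n and √n·δ/λ = 1/√(n+4).
Since C fixes even functions, the core S is an involution, and the core (ST)³ is conj α_Q(1) on one
summand and -α_{Q'}(1) on the other. The first tensor factor contributes the scalar α_Q(1), so the
relation holds iff α_Q(1)α_{Q'}(1) = -1 (`smul_core_cube_eq_one_iff`).

Verlinde numbers multiply under tensor products. For the core they reduce to sums of products of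
cosines over elements up to sign, which oddness makes explicit (`verlinde_sum_of_sorted`). An
identity with positive dimensions must lie in the class of 𝔞, since every other column of the core
has a zero or a sign change; nondegeneracy of Q then forces its G-component to be 0. -/

open scoped MatrixGroups ComplexConjugate Kronecker

namespace NearGroup

/-! ### The presentation of `SL(2, ℤ)` -/

section Presentation

/-- Products of copies of two elements `u` and `v`. -/
inductive IsWord {H : Type*} [Monoid H] (u v : H) : H → Prop
  | one : IsWord u v 1
  | mul_left {w : H} : IsWord u v w → IsWord u v (w * u)
  | mul_right {w : H} : IsWord u v w → IsWord u v (w * v)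

/-- The elements `(x ^ 2) ^ i * x ^ a * w * y ^ b` with `a < 2`, `b < 3` and `w` a product of
copies of `x ^ 2 * y * x` and `x ^ 2 * y ^ 2 * x`. -/
def IsNormalForm {H : Type*} [Monoid H] (x y p : H) : Prop :=
  ∃ i a b : ℕ, ∃ w, a < 2 ∧ b < 3 ∧ IsWord (x ^ 2 * y * x) (x ^ 2 * y ^ 2 * x) w ∧
    p = (x ^ 2) ^ i * x ^ a * w * y ^ b

variable {H : Type*} [Group H] {x y : H}

theorem IsNormalForm.mul_y (hxy : y ^ 3 = x ^ 2) {p : H}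
    (h : IsNormalForm x y p) : IsNormalForm x y (p * y) := by
  obtain ⟨i, a, b, w, ha, hb, hw, rfl⟩ := h
  by_cases hb2 : b < 2
  · exact ⟨i, a, b + 1, w, ha, by omega, hw, by rw [pow_succ y b, mul_assoc]⟩
  -- y³ = x² commutes with both x and y, so the overflow in the exponent of y is carried to the
  -- front as a power of x².
  · obtain rfl : b = 2 := by omega
    refine ⟨i + 1, a, 0, w, ha, by omega, hw, ?_⟩
    have hcx : Commute (x ^ 2) x := (Commute.refl x).pow_left 2
    have hcy : Commute (x ^ 2) y := hxy ▸ (Commute.refl y).pow_left 3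
    have hcw : Commute (x ^ 2) w := by
      induction hw with
      | one => exact Commute.one_right _
      | mul_left _ ih => exact ih.mul_right (((Commute.refl _).mul_right hcy).mul_right hcx)
      | mul_right _ ih =>
        exact ih.mul_right (((Commute.refl _).mul_right (hcy.pow_right 2)).mul_right hcx)
    have hc : Commute (x ^ 2) (x ^ a * w) := (hcx.pow_right a).mul_right hcw
    calc (x ^ 2) ^ i * x ^ a * w * y ^ 2 * y = (x ^ 2) ^ i * ((x ^ a * w) * y ^ 3) := by group
      _ = (x ^ 2) ^ i * (x ^ 2 * (x ^ a * w)) := by rw [hxy, hc.eq]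
      _ = _ := by group

/-- If b > 0, then y ^ b * x closes up into a new letter, at the cost of a factor x². If b = 0, the
trailing x of the last letter meets the new x, and the letter dissolves back into a power of y
because x² is an involution commuting with everything in sight. With an empty word, x is absorbed by
the exponent a. -/
theorem IsNormalForm.mul_x (hx : x ^ 4 = 1) (hxy : y ^ 3 = x ^ 2) {p : H}
    (h : IsNormalForm x y p) : IsNormalForm x y (p * x) := by
  obtain ⟨i, a, b, w, ha, hb, hw, rfl⟩ := h
  have hcx : Commute (x ^ 2) x := (Commute.refl x).pow_left 2
  have hcy : Commute (x ^ 2) y := hxy ▸ (Commute.refl y).pow_left 3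
  have hcw : ∀ {w}, IsWord (x ^ 2 * y * x) (x ^ 2 * y ^ 2 * x) w → Commute (x ^ 2) w := by
    intro w hw
    induction hw with
    | one => exact Commute.one_right _
    | mul_left _ ih => exact ih.mul_right (((Commute.refl _).mul_right hcy).mul_right hcx)
    | mul_right _ ih =>
      exact ih.mul_right (((Commute.refl _).mul_right (hcy.pow_right 2)).mul_right hcx)
  have hz : x ^ 2 * x ^ 2 = 1 := by rw [← pow_add, hx]
  have hc : ∀ {w}, IsWord (x ^ 2 * y * x) (x ^ 2 * y ^ 2 * x) w → Commute (x ^ 2) (x ^ a * w) :=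
    fun hw => (hcx.pow_right a).mul_right (hcw hw)
  have key : ∀ {w}, IsWord (x ^ 2 * y * x) (x ^ 2 * y ^ 2 * x) w → ∀ c : ℕ,
      (x ^ 2) ^ i * x ^ a * (w * (x ^ 2 * y ^ c * x)) * x = (x ^ 2) ^ i * x ^ a * w * y ^ c := by
    intro w hw c
    calc (x ^ 2) ^ i * x ^ a * (w * (x ^ 2 * y ^ c * x)) * x
        = (x ^ 2) ^ i * x ^ a * w * (x ^ 2 * y ^ c) * x ^ 2 := by
          rw [pow_two x]; simp only [mul_assoc]
      _ = (x ^ 2) ^ i * x ^ a * w * (y ^ c * x ^ 2) * x ^ 2 := by rw [(hcy.pow_right c).eq]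
      _ = (x ^ 2) ^ i * x ^ a * w * y ^ c * (x ^ 2 * x ^ 2) := by group
      _ = _ := by rw [hz, mul_one]
  have key2 : ∀ c : ℕ, (x ^ 2) ^ i * x ^ a * w * y ^ c * x
      = (x ^ 2) ^ (i + 1) * x ^ a * (w * (x ^ 2 * y ^ c * x)) * y ^ 0 := by
    intro c
    calc (x ^ 2) ^ i * x ^ a * w * y ^ c * x
        = (x ^ 2) ^ i * (x ^ 2 * x ^ 2) * (x ^ a * w) * y ^ c * x := by rw [hz]; group
      _ = (x ^ 2) ^ (i + 1) * (x ^ 2 * (x ^ a * w)) * y ^ c * x := by group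
      _ = (x ^ 2) ^ (i + 1) * ((x ^ a * w) * x ^ 2) * y ^ c * x := by rw [(hc hw).eq]
      _ = _ := by group
  interval_cases b
  · cases hw with
    | one =>
      interval_cases a
      · exact ⟨i, 1, 0, 1, by omega, by omega, .one, by simp⟩
      · exact ⟨i + 1, 0, 0, 1, by omega, by omega, .one, by simp [pow_succ, mul_assoc]⟩
    | @mul_left w hw =>
      refine ⟨i, a, 1, w, ha, by omega, hw, ?_⟩
      rw [← key hw]; simp
    | @mul_right w hw =>
      refine ⟨i, a, 2, w, ha, by omega, hw, ?_⟩
      rw [← key hw]; simp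
  · refine ⟨i + 1, a, 0, _, ha, by omega, hw.mul_left, ?_⟩
    rw [key2]; simp
  · exact ⟨i + 1, a, 0, _, ha, by omega, hw.mul_right, key2 2⟩

theorem isNormalForm_of_mem_closure (hx : x ^ 4 = 1) (hxy : y ^ 3 = x ^ 2) {p : H}
    (h : p ∈ Subgroup.closure {x, y}) : IsNormalForm x y p := by
  -- Finite order makes inverses positive powers, so closure under right multiplication by x and y
  -- is enough.
  have hy : y ^ 6 = 1 := by
    rw [show 6 = 3 * 2 from rfl, pow_mul, hxy, ← pow_mul, hx]
  induction h using Subgroup.closure_induction_right with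
  | one => exact ⟨0, 0, 0, 1, by omega, by omega, .one, by simp⟩
  | mul_right p hp q hq ih =>
    rcases hq with rfl | rfl
    · exact ih.mul_x hx hxy
    · exact ih.mul_y hxy
  | mul_inv_cancel p hp q hq ih =>
    rcases hq with rfl | rfl
    · have : q⁻¹ = q * q * q := inv_eq_of_mul_eq_one_right (by
        rw [← hx]; simp only [pow_succ, pow_zero, one_mul, mul_assoc])
      rw [this, ← mul_assoc, ← mul_assoc]
      exact ((ih.mul_x hx hxy).mul_x hx hxy).mul_x hx hxy
    · have : q⁻¹ = q * q * q * q * q := inv_eq_of_mul_eq_one_right (by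
        rw [← hy]; simp only [pow_succ, pow_zero, one_mul, mul_assoc])
      rw [this]
      simp only [← mul_assoc]
      exact ((((ih.mul_y hxy).mul_y hxy).mul_y hxy).mul_y hxy).mul_y hxy

/-- Right multiplication by u subtracts the second column from the first, and by v the first from
the second. With this sign pattern diagonal entries never decrease, and one off-diagonal entry drops
by a diagonal entry, hence by at least 1. -/
theorem IsWord.sign_pattern {u v w : SL(2, ℤ)}
    (hu : (u : Matrix (Fin 2) (Fin 2) ℤ) = !![1, 0; -1, 1])
    (hv : (v : Matrix (Fin 2) (Fin 2) ℤ) = !![1, -1; 0, 1]) (hw : IsWord u v w) :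
    1 ≤ w 0 0 ∧ 1 ≤ w 1 1 ∧ w 0 1 ≤ 0 ∧ w 1 0 ≤ 0 ∧ (w ≠ 1 → w 0 1 + w 1 0 < 0) := by
  induction hw with
  | one => simp
  | @mul_left w _ ih =>
    have h00 : (w * u) 0 0 = w 0 0 - w 0 1 := by
      simp [Matrix.mul_apply, hu, sub_eq_add_neg]
    have h01 : (w * u) 0 1 = w 0 1 := by simp [Matrix.mul_apply, hu]
    have h10 : (w * u) 1 0 = w 1 0 - w 1 1 := by
      simp [Matrix.mul_apply, hu, sub_eq_add_neg]
    have h11 : (w * u) 1 1 = w 1 1 := by simp [Matrix.mul_apply, hu]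
    rw [h00, h01, h10, h11]
    omega
  | @mul_right w _ ih =>
    have h00 : (w * v) 0 0 = w 0 0 := by simp [Matrix.mul_apply, hv]
    have h01 : (w * v) 0 1 = w 0 1 - w 0 0 := by
      simp [Matrix.mul_apply, hv]; ring
    have h10 : (w * v) 1 0 = w 1 0 := by simp [Matrix.mul_apply, hv]
    have h11 : (w * v) 1 1 = w 1 1 - w 1 0 := by
      simp [Matrix.mul_apply, hv]; ring
    rw [h00, h01, h10, h11]
    omega

theorem IsWord.map {H K : Type*} [Monoid H] [Monoid K] (f : H →* K) {u v w : H}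
    (hw : IsWord u v w) : IsWord (f u) (f v) (f w) := by
  induction hw with
  | one => simpa using IsWord.one
  | mul_left _ ih => simpa using ih.mul_left
  | mul_right _ ih => simpa using ih.mul_right

/-- The last letter of a nonempty word leaves a strictly negative off-diagonal entry in the image.
So the word itself is empty, which gives triviality upstairs without any injectivity of f. -/
theorem IsWord.eq_one_of_map_eq_one {H : Type*} [Monoid H] (f : H →* SL(2, ℤ)) {u v w : H}
    (hu : (f u : Matrix (Fin 2) (Fin 2) ℤ) = !![1, 0; -1, 1])
    (hv : (f v : Matrix (Fin 2) (Fin 2) ℤ) = !![1, -1; 0, 1])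
    (hw : IsWord u v w) (h : f w = 1) : w = 1 := by
  cases hw with
  | one => rfl
  | @mul_left w hw =>
    exfalso
    have h1 := (hw.map f).sign_pattern hu hv
    have h10 : (f w * f u) 1 0 = f w 1 0 - f w 1 1 := by
      simp [Matrix.mul_apply, hu, sub_eq_add_neg]
    rw [← map_mul, h] at h10
    simp at h10
    omega
  | @mul_right w hw =>
    exfalso
    have h1 := (hw.map f).sign_pattern hu hv
    have h01 : (f w * f v) 0 1 = f w 0 1 - f w 0 0 := by
      simp [Matrix.mul_apply, hv]; ring
    rw [← map_mul, h] at h01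
    simp at h01
    omega

theorem eq_one_of_isNormalForm {x y p : H} (f : H →* SL(2, ℤ)) (hx : x ^ 4 = 1)
    (hfx : f x = ModularGroup.S) (hfy : f y = ModularGroup.S * ModularGroup.T)
    (h : IsNormalForm x y p) (hp : f p = 1) : p = 1 := by
  obtain ⟨i, a, b, w, ha, hb, hw, rfl⟩ := h
  have hu : (f (x ^ 2 * y * x) : Matrix (Fin 2) (Fin 2) ℤ) = !![1, 0; -1, 1] := by
    simp only [map_mul, map_pow, hfx, hfy]; decide
  have hv : (f (x ^ 2 * y ^ 2 * x) : Matrix (Fin 2) (Fin 2) ℤ) = !![1, -1; 0, 1] := by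
    simp only [map_mul, map_pow, hfx, hfy]; decide
  have hs := (hw.map f).sign_pattern hu hv
  have hz : x ^ 2 * x ^ 2 = 1 := by rw [← pow_add, hx]
  have hzi : (x ^ 2) ^ i = 1 ∨ (x ^ 2) ^ i = x ^ 2 := by
    rcases Nat.even_or_odd' i with ⟨j, rfl | rfl⟩
    · left; rw [pow_mul, pow_two (x ^ 2), hz, one_pow]
    · right; rw [pow_succ, pow_mul, pow_two (x ^ 2), hz, one_pow, one_mul]
  have hS : ((ModularGroup.S : SL(2, ℤ)) : Matrix (Fin 2) (Fin 2) ℤ) = !![0, -1; 1, 0] := rfl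
  have hT : ((ModularGroup.T : SL(2, ℤ)) : Matrix (Fin 2) (Fin 2) ℤ) = !![1, 1; 0, 1] := rfl
  have hwm : ((f w : SL(2, ℤ)) : Matrix (Fin 2) (Fin 2) ℤ) =
      !![f w 0 0, f w 0 1; f w 1 0, f w 1 1] := Matrix.eta_fin_two _
  have hp' := hp
  simp only [map_mul, map_pow, hfx, hfy] at hp'
  have hp2 : ((ModularGroup.S ^ 2) ^ i * ModularGroup.S ^ a * f w *
      (ModularGroup.S * ModularGroup.T) ^ b : SL(2, ℤ)).1 = (1 : SL(2, ℤ)).1 :=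
    congrArg Subtype.val hp'
  have hfzi : (ModularGroup.S ^ 2 : SL(2, ℤ)) ^ i = 1 ∨
      (ModularGroup.S ^ 2 : SL(2, ℤ)) ^ i = ModularGroup.S ^ 2 := by
    rcases hzi with h | h
    · left; have := congrArg f h; simpa [hfx] using this
    · right; have := congrArg f h; simpa [hfx] using this
  generalize hA : f w 0 0 = A at *
  generalize hB : f w 0 1 = B at *
  generalize hC : f w 1 0 = C at *
  generalize hD : f w 1 1 = D at *
  obtain ⟨h1, h2, h3, h4, h5⟩ := hs
  by_cases hab : a = 0 ∧ b = 0
  · obtain ⟨rfl, rfl⟩ := hab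
    have hw1 : w = 1 := by
      apply hw.eq_one_of_map_eq_one f hu hv
      by_contra hne
      have h6 := h5 hne
      rcases hfzi with h | h <;> rw [h] at hp2 <;>
      · simp only [Matrix.SpecialLinearGroup.coe_mul,
          hwm, hS, pow_zero, mul_one, one_mul, pow_two, Matrix.mul_fin_two,
          Matrix.SpecialLinearGroup.coe_one, Matrix.one_fin_two] at hp2
        have e1 := congrFun (congrFun hp2 0) 1
        have e2 := congrFun (congrFun hp2 1) 0
        simp at e1 e2
        omega
    subst hw1
    simp only [pow_zero, mul_one] at hp ⊢
    rcases hzi with h | h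
    · exact h
    · exfalso
      rw [h, map_pow, hfx] at hp
      revert hp; decide
  · exfalso
    interval_cases a <;> interval_cases b <;> first | exact hab ⟨rfl, rfl⟩ | skip
    -- For the five remaining (a, b) and either sign of the central factor, the entries of the
    -- product are linear in A, B, C, D, and the sign pattern prevents them from being those of the
    -- identity.
    all_goals
      rcases hfzi with h | h <;> rw [h] at hp2 <;>
      · simp only [Matrix.SpecialLinearGroup.coe_mul,
          hwm, hS, hT, pow_zero, mul_one, one_mul, pow_two, pow_one, Matrix.mul_fin_two,
          Matrix.SpecialLinearGroup.coe_one, Matrix.one_fin_two] at hp2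
        have e1 := congrFun (congrFun hp2 0) 1
        have e2 := congrFun (congrFun hp2 1) 0
        have e3 := congrFun (congrFun hp2 0) 0
        have e4 := congrFun (congrFun hp2 1) 1
        simp at e1 e2 e3 e4
        omega

/-- `S` and `T` with `S ^ 4 = 1`, `(S T) ^ 3 = S ^ 2` present `SL(2, ℤ)`. -/
theorem exists_hom_group {M : Type*} [Group M] (s t : M) (hs : s ^ 4 = 1)
    (hst : (s * t) ^ 3 = s ^ 2) :
    ∃ ρ : SL(2, ℤ) →* M, ρ ModularGroup.S = s ∧ ρ ModularGroup.T = t := by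
  let x : SL(2, ℤ) × M := (ModularGroup.S, s)
  let y : SL(2, ℤ) × M := (ModularGroup.S * ModularGroup.T, s * t)
  -- K is the graph of the homomorphism sought: the normal form makes its first projection
  -- injective, and generation of SL(2, ℤ) makes it surjective.
  let K : Subgroup (SL(2, ℤ) × M) := Subgroup.closure {x, y}
  have hx : x ^ 4 = 1 := Prod.ext (show ModularGroup.S ^ 4 = 1 by decide) hs
  have hxy : y ^ 3 = x ^ 2 := Prod.ext
    (show (ModularGroup.S * ModularGroup.T) ^ 3 = ModularGroup.S ^ 2 by decide) hst
  have hxK : x ∈ K := Subgroup.subset_closure (by simp)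
  have hyK : y ∈ K := Subgroup.subset_closure (by simp)
  have htK : (ModularGroup.T, t) ∈ K := by
    have : ((ModularGroup.T, t) : SL(2, ℤ) × M) = x⁻¹ * y := by simp [x, y]
    rw [this]
    exact K.mul_mem (K.inv_mem hxK) hyK
  let f : K →* SL(2, ℤ) := (MonoidHom.fst _ _).comp K.subtype
  have hinj : Function.Injective f := by
    rw [injective_iff_map_eq_one]
    rintro ⟨p, hp⟩ h
    exact Subtype.ext (eq_one_of_isNormalForm (MonoidHom.fst _ _) hx rfl rfl
      (isNormalForm_of_mem_closure hx hxy hp) h)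
  have hsurj : Function.Surjective f := by
    rw [← MonoidHom.range_eq_top, eq_top_iff,
      ← SpecialLinearGroup.SL2Z_generators, Subgroup.closure_le]
    rintro _ (rfl | rfl)
    · exact ⟨⟨x, hxK⟩, rfl⟩
    · exact ⟨⟨_, htK⟩, rfl⟩
  let e : K ≃* SL(2, ℤ) := MulEquiv.ofBijective f ⟨hinj, hsurj⟩
  refine ⟨((MonoidHom.snd _ _).comp K.subtype).comp e.symm.toMonoidHom, ?_, ?_⟩
  · have : e.symm ModularGroup.S = ⟨x, hxK⟩ := e.symm_apply_eq.2 rfl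
    simp [this, x]
  · have : e.symm ModularGroup.T = ⟨_, htK⟩ := e.symm_apply_eq.2 rfl
    simp [this]

theorem exists_hom_iff {M : Type*} [Monoid M] (s t : M) :
    (∃ ρ : SL(2, ℤ) →* M, ρ ModularGroup.S = s ∧ ρ ModularGroup.T = t) ↔
      s ^ 4 = 1 ∧ (s * t) ^ 3 = s ^ 2 := by
  constructor
  · rintro ⟨ρ, rfl, rfl⟩
    rw [← map_mul, ← map_pow, ← map_pow, ← map_pow, ← map_one ρ]
    exact ⟨congrArg ρ (by decide), congrArg ρ (by decide)⟩
  · rintro ⟨hs, hst⟩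
    -- The relations make s and st units, hence also t, and the problem moves to the group of units.
    have hst6 : (s * t) ^ 6 = 1 := by
      rw [show 6 = 3 * 2 from rfl, pow_mul, hst, ← pow_mul, hs]
    obtain ⟨s, rfl⟩ : IsUnit s := IsUnit.of_pow_eq_one hs (by norm_num)
    obtain ⟨r, hr⟩ : IsUnit ((s : M) * t) := IsUnit.of_pow_eq_one hst6 (by norm_num)
    obtain rfl : t = ((s⁻¹ * r : Mˣ) : M) := by rw [Units.val_mul, hr, Units.inv_mul_cancel_left]
    obtain ⟨ρ, h1, h2⟩ := exists_hom_group s (s⁻¹ * r) (Units.ext (by simpa using hs))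
      (Units.ext (by simpa using hst))
    exact ⟨(Units.coeHom M).comp ρ, by simp [h1], by simp [h2]⟩

end Presentation

/-! ### The exponential on `ℚ/ℤ` -/

theorem qzExp_add (x y : AddCircle (1 : ℚ)) : qzExp (x + y) = qzExp x * qzExp y := by
  induction x using QuotientAddGroup.induction_on with
  | H p =>
    induction y using QuotientAddGroup.induction_on with
    | H q =>
      have h := qzExp_coe (p + q)
      rw [Rat.cast_add, mul_add, Complex.exp_add, ← qzExp_coe, ← qzExp_coe] at h
      exact h

@[simp] theorem qzExp_zero : qzExp 0 = 1 := by
  have h := qzExp_coe 0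
  simpa using h

/-- `qzExp` as an additive character. -/
noncomputable def qzChar : AddChar (AddCircle (1 : ℚ)) ℂ where
  toFun := qzExp
  map_zero_eq_one' := qzExp_zero
  map_add_eq_mul' := qzExp_add

theorem qzExp_neg (x : AddCircle (1 : ℚ)) : qzExp (-x) = conj (qzExp x) := by
  rw [conj_qzExp]; exact qzChar.map_neg_eq_inv x

theorem qzExp_nsmul (n : ℕ) (x : AddCircle (1 : ℚ)) : qzExp (n • x) = qzExp x ^ n :=
  qzChar.map_nsmul_eq_pow n x

theorem qzExp_mul_conj (x : AddCircle (1 : ℚ)) : qzExp x * conj (qzExp x) = 1 := by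
  rw [← qzExp_neg, ← qzExp_add, add_neg_cancel, qzExp_zero]

theorem qzExp_ne_zero (x : AddCircle (1 : ℚ)) : qzExp x ≠ 0 :=
  left_ne_zero_of_mul_eq_one (qzExp_mul_conj x)

theorem isOfFinOrder_qzExp (x : AddCircle (1 : ℚ)) : IsOfFinOrder (qzExp x) := by
  induction x using QuotientAddGroup.induction_on with
  | H q =>
    refine isOfFinOrder_iff_pow_eq_one.2 ⟨q.den, q.den_pos, ?_⟩
    rw [← qzExp_nsmul]
    have h : q.den • (q : AddCircle (1 : ℚ)) = 0 := by
      rw [← AddCircle.coe_nsmul, AddCircle.coe_eq_zero_iff]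
      exact ⟨q.num, by simp [mul_comm]⟩
    exact (congrArg qzExp h).trans qzExp_zero

theorem sqrt_card_mul_self {G : Type*} [Fintype G] :
    (Real.sqrt (Fintype.card G) : ℂ) * Real.sqrt (Fintype.card G)
    = Fintype.card G := by
  rw [← Complex.ofReal_mul, Real.mul_self_sqrt (Nat.cast_nonneg _), Complex.ofReal_natCast]

theorem sqrt_card_ne_zero {G : Type*} [Fintype G] [Nonempty G] : (Real.sqrt (Fintype.card G) : ℂ) ≠ 0 := by
  have : 0 < Real.sqrt (Fintype.card G) := Real.sqrt_pos.2 (by exact_mod_cast Fintype.card_pos)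
  exact_mod_cast this.ne'

namespace NondegQuadForm

variable {G : Type*} [AddCommGroup G] (Q : NondegQuadForm G)

/-- The character `h ↦ ⟨g, h⟩_Q`. -/
noncomputable def pairingChar (g : G) : AddChar G ℂ := (Q.nondeg.pairing.1 g).choose

theorem pairingChar_apply (g h : G) : Q.pairingChar g h = Q.pairing g h :=
  ((Q.nondeg.pairing.1 g).choose_spec h).symm

theorem pairing_add_right (g h k : G) : Q.pairing g (h + k) = Q.pairing g h * Q.pairing g k := by
  simp only [← pairingChar_apply, AddChar.map_add_eq_mul]

theorem pairing_add_left (g h k : G) : Q.pairing (g + h) k = Q.pairing g k * Q.pairing h k := by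
  simp only [Q.pairing_comm _ k, pairing_add_right]

@[simp] theorem pairing_zero_right (g : G) : Q.pairing g 0 = 1 := by
  rw [← pairingChar_apply, AddChar.map_zero_eq_one]

@[simp] theorem pairing_zero_left (g : G) : Q.pairing 0 g = 1 := by
  rw [pairing_comm, pairing_zero_right]

theorem pairing_neg_right (g h : G) : Q.pairing g (-h) = conj (Q.pairing g h) := by
  rw [pairing_comm, pairing_neg_left, pairing_comm]

theorem pairing_mul_conj (g h : G) : Q.pairing g h * conj (Q.pairing g h) = 1 := qzExp_mul_conj _

theorem eq_zero_of_pairing_eq_one {g : G} (h : ∀ k, Q.pairing k g = 1) : g = 0 := by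
  apply Q.nondeg.nondeg
  funext k
  change Q.pairing g k = Q.pairing 0 k
  rw [pairing_comm, h, pairing_zero_left]

theorem toFun_add (g h : G) : qzExp (Q.toFun (g + h)) =
    Q.pairing g h * qzExp (Q.toFun g) * qzExp (Q.toFun h) := by
  rw [pairing, ← qzExp_add, ← qzExp_add]
  congr 1
  abel

@[simp] theorem toFun_zero : qzExp (Q.toFun 0) = 1 := by
  have h := Q.toFun_add 0 0
  rw [add_zero, pairing_zero_left, one_mul] at h
  exact (mul_eq_left₀ (qzExp_ne_zero _)).1 h.symm

theorem toFun_sub (g h : G) : qzExp (Q.toFun (g - h)) =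
    conj (Q.pairing g h) * qzExp (Q.toFun g) * qzExp (Q.toFun h) := by
  rw [sub_eq_add_neg, toFun_add, pairing_neg_right, Q.even]

/-- Expand Q(g - g) = Q(0) using evenness. -/
theorem pairing_self (g : G) : Q.pairing g g = qzExp (Q.toFun g) ^ 2 := by
  have h := Q.toFun_sub g g
  rw [sub_self, toFun_zero] at h
  linear_combination Q.pairing g g * h + qzExp (Q.toFun g) ^ 2 * Q.pairing_mul_conj g g

theorem toFun_nsmul (m : ℕ) (g : G) : qzExp (Q.toFun (m • g)) = qzExp (Q.toFun g) ^ (m ^ 2) := by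
  induction m with
  | zero => simp
  | succ m ih =>
    have : Q.pairing (m • g) g = (qzExp (Q.toFun g) ^ 2) ^ m := by
      rw [pairing_comm, ← pairingChar_apply, AddChar.map_nsmul_eq_pow, pairingChar_apply,
        pairing_self]
    rw [succ_nsmul, toFun_add, ih, this]
    ring

/-- The form `-Q`. -/
noncomputable def neg : NondegQuadForm G where
  toFun g := -Q.toFun g
  even g := by rw [Q.even]
  nondeg := by
    have h : ∀ g h, qzExp (-Q.toFun (g + h) - -Q.toFun g - -Q.toFun h) = Q.pairing (-g) h := by
      intro g h
      rw [pairing_neg_left, pairing, ← qzExp_neg]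
      congr 1
      abel
    refine ⟨⟨fun g => ⟨Q.pairingChar (-g), fun k => (h g k).trans ?_⟩,
      fun k => ⟨Q.pairingChar (-k), fun g => (h g k).trans ?_⟩⟩,
      fun g k => ?_, fun g k hgk => ?_⟩
    · rw [pairingChar_apply]
    · rw [pairingChar_apply, pairing_neg_left, pairing_neg_left, pairing_comm]
    · rw [h, h, pairing_neg_left, pairing_neg_left, pairing_comm]
    · rw [← neg_inj]
      apply Q.nondeg.nondeg
      funext l
      have := congrFun hgk l
      simp only [h] at this
      exact this

theorem neg_pairing (g h : G) : Q.neg.pairing g h = conj (Q.pairing g h) := by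
  rw [pairing, pairing, ← qzExp_neg]
  congr 1
  simp only [neg]
  abel

theorem qzExp_neg_toFun (g : G) : qzExp (Q.neg.toFun g) = conj (qzExp (Q.toFun g)) := by
  rw [← qzExp_neg]; rfl

/-- A positive ratio of numbers of modulus 1 is 1, so the character attached to e is constant, equal
to its value 1 at 0; nondegeneracy finishes. -/
theorem eq_zero_of_conj_pairing_pos {e : G}
    (h : ∀ g, ∃ r : ℝ, 0 < r ∧ conj (Q.pairing g e) / conj (Q.pairing e e) = r) : e = 0 := by
  have key : ∀ g, conj (Q.pairing g e) = conj (Q.pairing e e) := by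
    intro g
    obtain ⟨r, hr, hg⟩ := h g
    have hnorm : ∀ a b, ‖Q.pairing a b‖ = 1 := fun a b => (isOfFinOrder_qzExp _).norm_eq_one
    have h1 := congrArg norm hg
    rw [norm_div, RCLike.norm_conj, RCLike.norm_conj, hnorm, hnorm, Complex.norm_real,
      Real.norm_of_nonneg hr.le, div_one] at h1
    rw [← h1, Complex.ofReal_one, div_eq_one_iff_eq] at hg
    · exact hg
    · exact right_ne_zero_of_mul_eq_one (Q.pairing_mul_conj e e)
  refine Q.eq_zero_of_pairing_eq_one fun g => ?_
  have h0 := key 0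
  rw [pairing_zero_left, ← key g, map_one] at h0
  rw [← Complex.conj_conj (Q.pairing g e), ← h0, map_one]

variable [Fintype G]

theorem sum_pairing [DecidableEq G] (g : G) :
    ∑ k, Q.pairing g k = if g = 0 then (Fintype.card G : ℂ) else 0 := by
  classical
  simp only [← pairingChar_apply]
  rw [AddChar.sum_eq_ite]
  have : Q.pairingChar g = 0 ↔ g = 0 := by
    constructor
    · intro h
      refine Q.eq_zero_of_pairing_eq_one fun k => ?_
      rw [pairing_comm, ← pairingChar_apply, h, AddChar.zero_apply]
    · rintro rfl
      ext k
      rw [pairingChar_apply, pairing_zero_left, AddChar.zero_apply]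
  simp only [this]

theorem sum_conj_pairing [DecidableEq G] (g : G) :
    ∑ k, conj (Q.pairing g k) = if g = 0 then (Fintype.card G : ℂ) else 0 := by
  rw [← map_sum, sum_pairing]
  split_ifs <;> simp

theorem sum_toFun : ∑ k, qzExp (Q.toFun k) = Real.sqrt (Fintype.card G) * Q.gaussSum 1 := by
  simp only [gaussSum, one_smul]
  field_simp [sqrt_card_ne_zero (G := G)]

theorem gaussSum_neg_one : Q.gaussSum (-1) = conj (Q.gaussSum 1) := by
  simp [gaussSum, qzExp_neg]

theorem neg_gaussSum : Q.neg.gaussSum 1 = conj (Q.gaussSum 1) := by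
  simp [gaussSum, qzExp_neg_toFun]

end NondegQuadForm

/-! ### The relations satisfied by the Weil matrices -/

section Weil

variable {G : Type*} [AddCommGroup G] [Fintype G] (Q : NondegQuadForm G)

open NondegQuadForm

theorem weilS_isSymm (α : ℂ) : (weilS Q α).IsSymm := by
  ext g h
  simp [weilS, Q.pairing_comm g h]

theorem weilS_zero_right (α : ℂ) (g : G) :
    weilS Q α g 0 = α / Real.sqrt (Fintype.card G) := by
  simp [weilS]

variable [DecidableEq G]

theorem weilS_mul_self (α : ℂ) :
    weilS Q α * weilS Q α = Matrix.of fun g h => if g + h = 0 then α ^ 2 else 0 := by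
  ext g h
  have hn := sqrt_card_mul_self (G := G)
  have h0 := sqrt_card_ne_zero (G := G)
  have : ∀ k, weilS Q α g k * weilS Q α k h =
      α ^ 2 / (Fintype.card G : ℂ) * conj (Q.pairing (g + h) k) := by
    intro k
    rw [pairing_add_left, Q.pairing_comm h k, map_mul, ← hn]
    simp only [weilS, Matrix.of_apply]
    field_simp
  rw [Matrix.mul_apply, Finset.sum_congr rfl fun k _ => this k, ← Finset.mul_sum,
    sum_conj_pairing, Matrix.of_apply]
  split_ifs
  · have : (Fintype.card G : ℂ) ≠ 0 := by rw [← hn]; exact mul_ne_zero h0 h0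
    field_simp
  · simp

theorem weilS_pow_four (α : ℂ) : weilS Q α ^ 4 = (α ^ 4) • (1 : Matrix G G ℂ) := by
  rw [show 4 = 2 * 2 from rfl, pow_mul, pow_two (weilS Q α), weilS_mul_self, pow_two]
  ext g h
  rw [Matrix.mul_apply, Finset.sum_eq_single (-g)]
  · simp only [Matrix.of_apply, add_neg_cancel, if_true, Matrix.smul_apply, Matrix.one_apply,
      neg_add_eq_zero]
    split_ifs <;> simp
    ring
  · intro k _ hk
    have : g + k ≠ 0 := fun h => hk (neg_eq_of_add_eq_zero_right h).symm
    simp [this]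
  · simp

/-- Completing the square turns the summand into a constant times e(Q(k - (g + h))), and translating
k leaves the Gauss sum. -/
theorem weilS_mul_weilT_mul_weilS (α β : ℂ) (g h : G) :
    (weilS Q α * weilT Q β * weilS Q α) g h =
      α ^ 2 * β / Real.sqrt (Fintype.card G) * Q.gaussSum 1 * conj (qzExp (Q.toFun (g + h))) := by
  have hn := sqrt_card_mul_self (G := G)
  have h0 := sqrt_card_ne_zero (G := G)
  have : ∀ k, weilS Q α g k * (β * qzExp (Q.toFun k)) * weilS Q α k h =
      α ^ 2 * β / (Fintype.card G : ℂ) * conj (qzExp (Q.toFun (g + h))) *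
        qzExp (Q.toFun (k - (g + h))) := by
    intro k
    rw [toFun_sub, pairing_add_right, Q.pairing_comm k g, map_mul, ← hn]
    have h1 := qzExp_mul_conj (Q.toFun (g + h))
    simp only [weilS, Matrix.of_apply]
    field_simp
    linear_combination (-(α ^ 2 * β * conj (Q.pairing g k) * conj (Q.pairing k h) *
      qzExp (Q.toFun k))) * h1
  rw [weilT, Matrix.mul_apply]
  simp only [Matrix.mul_diagonal]
  rw [Finset.sum_congr rfl fun k _ => this k, ← Finset.mul_sum,
    Fintype.sum_equiv (Equiv.subRight (g + h)) (fun k => qzExp (Q.toFun (k - (g + h))))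
      (fun k => qzExp (Q.toFun k)) (fun k => rfl), sum_toFun, ← hn]
  field_simp

/-- Group the product as (STS)(TST): the quadratic factors e(Q(k)) of the summation index cancel and
a plain character sum in k remains, which is supported on g + h = 0 just like S². -/
theorem weil_cube (α β : ℂ) :
    (weilS Q α * weilT Q β) ^ 3 = (α * β ^ 3 * Q.gaussSum 1) • weilS Q α ^ 2 := by
  have hn := sqrt_card_mul_self (G := G)
  have h0 := sqrt_card_ne_zero (G := G)
  have h1 : (weilS Q α * weilT Q β) ^ 3 =
      (weilS Q α * weilT Q β * weilS Q α) * (weilT Q β * weilS Q α * weilT Q β) := by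
    simp only [pow_succ, pow_zero, one_mul, mul_assoc]
  ext g h
  rw [h1, Matrix.mul_apply]
  have : ∀ k, (weilS Q α * weilT Q β * weilS Q α) g k * (weilT Q β * weilS Q α * weilT Q β) k h =
      α ^ 3 * β ^ 3 * Q.gaussSum 1 / (Fintype.card G : ℂ) * conj (qzExp (Q.toFun g)) *
        qzExp (Q.toFun h) * conj (Q.pairing (g + h) k) := by
    intro k
    rw [weilS_mul_weilT_mul_weilS, toFun_add, pairing_add_left, Q.pairing_comm h k, map_mul,
      map_mul, map_mul, ← hn]
    have h2 := qzExp_mul_conj (Q.toFun k)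
    simp only [weilS, weilT, Matrix.of_apply, Matrix.mul_diagonal, Matrix.diagonal_mul]
    field_simp
    linear_combination (α ^ 3 * β ^ 3 * Q.gaussSum 1 * conj (Q.pairing g k) *
      conj (qzExp (Q.toFun g)) * conj (Q.pairing k h) * qzExp (Q.toFun h)) * h2
  rw [Finset.sum_congr rfl fun k _ => this k, ← Finset.mul_sum, sum_conj_pairing,
    Matrix.smul_apply, pow_two (weilS Q α), weilS_mul_self, Matrix.of_apply, smul_eq_mul]
  split_ifs with hgh
  · have hh : h = -g := (neg_eq_of_add_eq_zero_right hgh).symm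
    have h2 := qzExp_mul_conj (Q.toFun g)
    have : (Fintype.card G : ℂ) ≠ 0 := by rw [← hn]; exact mul_ne_zero h0 h0
    rw [hh, Q.even]
    field_simp
    linear_combination (α ^ 3 * β ^ 3 * Q.gaussSum 1) * h2
  · simp

theorem isOfFinOrder_diagonal {ι : Type*} [Fintype ι] [DecidableEq ι] {d : ι → ℂ}
    (h : ∀ i, IsOfFinOrder (d i)) : IsOfFinOrder (Matrix.diagonal d) := by
  have : IsOfFinOrder d := by
    refine isOfFinOrder_iff_pow_eq_one.2 ⟨∏ i, orderOf (d i),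
      Finset.prod_pos fun i _ => (h i).orderOf_pos, ?_⟩
    funext i
    exact orderOf_dvd_iff_pow_eq_one.1 (Finset.dvd_prod_of_mem _ (Finset.mem_univ i))
  exact (Matrix.diagonalRingHom ι ℂ).toMonoidHom.isOfFinOrder this

theorem weilT_isOfFinOrder {β : ℂ} (hβ : IsOfFinOrder β) : IsOfFinOrder (weilT Q β) :=
  isOfFinOrder_diagonal fun g => hβ.mul (isOfFinOrder_qzExp (Q.toFun g))

theorem smul_weilS_sq_inj {c d : ℂ} {α : ℂ} (hα : α ≠ 0)
    (h : c • weilS Q α ^ 2 = d • weilS Q α ^ 2) : c = d := by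
  have h1 := congrFun (congrFun h 0) 0
  rw [pow_two (weilS Q α), weilS_mul_self] at h1
  simpa [hα] using h1

/-- Gauss sums of nondegenerate forms are roots of unity. -/
theorem isOfFinOrder_gaussSum : IsOfFinOrder (Q.gaussSum 1) := by
  -- Determinants express α_Q(1) ^ |G| through det S and det T, which are roots of unity; this
  -- replaces a direct evaluation of the modulus of the Gauss sum.
  have h1 := congrArg Matrix.det (weil_cube Q 1 1)
  have h4 := congrArg Matrix.det (weilS_pow_four Q 1)
  simp only [one_mul, one_pow, one_smul, Matrix.det_smul, Matrix.det_pow, Matrix.det_mul,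
    Matrix.det_one] at h1 h4
  have hS : IsOfFinOrder (weilS Q 1).det := isOfFinOrder_iff_pow_eq_one.2 ⟨4, by norm_num, h4⟩
  have hT : IsOfFinOrder (weilT Q 1).det :=
    Matrix.detMonoidHom.isOfFinOrder (weilT_isOfFinOrder Q IsOfFinOrder.one)
  have h2 : Q.gaussSum 1 ^ Fintype.card G =
      ((weilS Q 1).det * (weilT Q 1).det) ^ 3 * (weilS Q 1).det ^ 2 := by
    rw [h1, mul_assoc, ← pow_add, h4, mul_one]
  refine IsOfFinOrder.of_pow (n := Fintype.card G) ?_ Fintype.card_ne_zero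
  rw [h2]
  exact ((hS.mul hT).pow).mul hS.pow

theorem gaussSum_mul_conj : Q.gaussSum 1 * conj (Q.gaussSum 1) = 1 := by
  rw [Complex.mul_conj, Complex.normSq_eq_norm_sq, (isOfFinOrder_gaussSum Q).norm_eq_one]
  simp

theorem diagonal_mem_unitaryGroup {ι : Type*} [Fintype ι] [DecidableEq ι] {d : ι → ℂ}
    (h : ∀ i, IsOfFinOrder (d i)) : Matrix.diagonal d ∈ Matrix.unitaryGroup ι ℂ := by
  rw [Matrix.mem_unitaryGroup_iff, Matrix.star_eq_conjTranspose, Matrix.diagonal_conjTranspose,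
    Matrix.diagonal_mul_diagonal, ← Matrix.diagonal_one]
  congr 1
  funext i
  rw [Pi.star_apply, Complex.star_def, Complex.mul_conj, Complex.normSq_eq_norm_sq,
    (h i).norm_eq_one]
  simp

theorem weilS_mem_unitaryGroup {α : ℂ} (hα : α = 1 ∨ α = -1) :
    weilS Q α ∈ Matrix.unitaryGroup G ℂ := by
  have h1 : star (weilS Q α) = Matrix.of fun g h => weilS Q α (-g) h := by
    ext g h
    rcases hα with rfl | rfl <;>
    simp [weilS, Matrix.star_apply, Q.pairing_neg_left, Q.pairing_comm g h]
  rw [Matrix.mem_unitaryGroup_iff', h1]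
  ext g h
  have h2 := congrFun (congrFun (weilS_mul_self Q α) (-g)) h
  rw [Matrix.mul_apply] at h2 ⊢
  simp only [Matrix.of_apply] at h2 ⊢
  rw [h2, Matrix.one_apply]
  simp only [neg_add_eq_zero]
  rcases hα with rfl | rfl <;> simp

theorem weilS_isIdentityFor {α : ℂ} (hα : α = 1 ∨ α = -1) : IsIdentityFor (weilS Q α) 0 := by
  have hn := sqrt_card_mul_self (G := G)
  have h0 := sqrt_card_ne_zero (G := G)
  have hα2 : α ^ 2 = 1 := by rcases hα with rfl | rfl <;> simp
  have hα0 : α ≠ 0 := by rintro rfl; simp at hα2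
  have hN : (Fintype.card G : ℂ) ≠ 0 := by rw [← hn]; exact mul_ne_zero h0 h0
  constructor
  · intro a
    refine ⟨1 / Fintype.card G, by have := Fintype.card_pos (α := G); positivity, ?_⟩
    rw [weilS_zero_right, div_pow, hα2, pow_two, hn]
    simp
  · intro a b c
    have : ∀ d, weilS Q α a d * weilS Q α b d * weilS Q α c d / weilS Q α 0 d =
        α ^ 2 / (Fintype.card G : ℂ) * conj (Q.pairing (a + b + c) d) := by
      intro d
      rw [pairing_add_left, pairing_add_left, map_mul, map_mul, ← hn]
      simp only [weilS, Matrix.of_apply, pairing_zero_left, map_one, mul_one]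
      field_simp
    rw [Finset.sum_congr rfl fun d _ => this d, ← Finset.mul_sum, sum_conj_pairing, hα2]
    split_ifs
    · exact ⟨1, by simp [hN]⟩
    · exact ⟨0, by simp⟩

theorem weil_isModularData_iff (α β : ℂ) :
    IsModularData (weilS Q α) (weilT Q β) ↔
      (α = 1 ∨ α = -1) ∧ β ^ 3 = α * Q.gaussSum (-1) := by
  have hg := gaussSum_mul_conj Q
  have h0 := sqrt_card_ne_zero (G := G)
  have hn := sqrt_card_mul_self (G := G)
  have hcard : (0 : ℝ) < Fintype.card G := by exact_mod_cast Fintype.card_pos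
  constructor
  · intro h
    obtain ⟨h4, h3⟩ := (exists_hom_iff _ _).1 h.rep
    have hα4 : α ^ 4 = 1 := by
      rw [weilS_pow_four] at h4
      simpa using congrFun (congrFun h4 0) 0
    obtain ⟨e, he⟩ := h.identity
    obtain ⟨r, hr, her⟩ := he.sq_pos 0
    -- In row 0 the pairing is 1 whatever the identity e may be, so positivity there says that α² is
    -- a positive real; with α⁴ = 1 this gives α² = 1.
    have hα2 : α ^ 2 = ((r * Fintype.card G : ℝ) : ℂ) := by
      have : weilS Q α 0 e = α / Real.sqrt (Fintype.card G) := by simp [weilS]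
      rw [this, div_pow, pow_two (Real.sqrt _ : ℂ), hn, div_eq_iff] at her
      · rw [her]; push_cast; rfl
      · rw [← hn]; exact mul_ne_zero h0 h0
    have hα : α ^ 2 = 1 := by
      have hp : 0 < r * Fintype.card G := mul_pos hr hcard
      have h5 : (r * Fintype.card G) ^ 2 = 1 := by
        have : ((r * Fintype.card G : ℝ) : ℂ) ^ 2 = 1 := by rw [← hα2, ← pow_mul, hα4]
        exact_mod_cast this
      rw [hα2, (pow_eq_one_iff_of_nonneg hp.le two_ne_zero).1 h5, Complex.ofReal_one]
    have hα0 : α ≠ 0 := by rintro rfl; simp at hα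
    refine ⟨sq_eq_one_iff.1 hα, ?_⟩
    rw [weil_cube] at h3
    have h6 := smul_weilS_sq_inj Q hα0 (h3.trans (one_smul _ _).symm)
    rw [gaussSum_neg_one]
    linear_combination (α * conj (Q.gaussSum 1)) * h6 - β ^ 3 * α ^ 2 * hg - β ^ 3 * hα
  · rintro ⟨hα, hβ⟩
    have hα2 : α ^ 2 = 1 := by rcases hα with rfl | rfl <;> simp
    have hαf : IsOfFinOrder α := isOfFinOrder_iff_pow_eq_one.2 ⟨2, by norm_num, hα2⟩
    rw [gaussSum_neg_one] at hβ
    have hβf : IsOfFinOrder β := by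
      refine IsOfFinOrder.of_pow (n := 3) ?_ (by norm_num)
      rw [hβ]
      exact hαf.mul ((starRingEnd ℂ).toMonoidHom.isOfFinOrder (isOfFinOrder_gaussSum Q))
    refine ⟨weilS_mem_unitaryGroup Q hα, diagonal_mem_unitaryGroup fun g =>
      hβf.mul (isOfFinOrder_qzExp _), weilS_isSymm Q α, Matrix.isDiag_diagonal _,
      weilT_isOfFinOrder Q hβf, (exists_hom_iff _ _).2 ⟨?_, ?_⟩, 0, weilS_isIdentityFor Q hα⟩
    · rw [weilS_pow_four, show α ^ 4 = (α ^ 2) ^ 2 by ring, hα2, one_pow, one_smul]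
    · rw [weil_cube, hβ]
      have : α * (α * conj (Q.gaussSum 1)) * Q.gaussSum 1 = 1 := by
        linear_combination α ^ 2 * hg + hα2
      rw [this, one_smul]

theorem weil_identity_unique {α β : ℂ} (h : IsModularData (weilS Q α) (weilT Q β)) (e : G) :
    (IsIdentityFor (weilS Q α) e ∧ HasPosDims (weilS Q α) e) ↔ e = 0 := by
  have hα := ((weil_isModularData_iff Q α β).1 h).1
  have hα0 : α ≠ 0 := by rintro rfl; simp at hα
  have h0 := sqrt_card_ne_zero (G := G)
  constructor
  · rintro ⟨-, he⟩
    refine Q.eq_zero_of_conj_pairing_pos fun g => ?_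
    obtain ⟨r, hr, hg⟩ := he g
    refine ⟨r, hr, ?_⟩
    rw [← hg]
    simp only [weilS, Matrix.of_apply]
    rw [mul_div_mul_left _ _ (div_ne_zero hα0 h0)]
  · rintro rfl
    refine ⟨weilS_isIdentityFor Q hα, fun g => ⟨1, one_pos, ?_⟩⟩
    rw [weilS_zero_right, weilS_zero_right, div_self (div_ne_zero hα0 h0), Complex.ofReal_one]

end Weil

/-! ### Groups of odd order -/

section Odd

variable {G : Type*} [AddCommGroup G] [Fintype G]

theorem eq_zero_of_add_self_of_odd (hG : Odd (Fintype.card G)) {g : G} (h : g + g = 0) : g = 0 := by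
  obtain ⟨k, hk⟩ := hG
  have h1 : Fintype.card G • g = 0 := card_nsmul_eq_zero
  rw [hk, add_smul, mul_comm, mul_smul, two_smul, h, smul_zero, zero_add, one_smul] at h1
  exact h1

theorem exists_add_self_of_odd (hG : Odd (Fintype.card G)) (g : G) : ∃ h, h + h = g := by
  have hinj : Function.Injective fun h : G => h + h := by
    intro h k hhk
    have : (h - k) + (h - k) = 0 := by
      have : h + h = k + k := hhk
      rw [sub_add_sub_comm, this, sub_self]
    exact sub_eq_zero.1 (eq_zero_of_add_self_of_odd hG this)
  exact Finite.surjective_of_injective hinj g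

namespace NondegQuadForm

variable (Q : NondegQuadForm G)

theorem halfPairing_add_left (g h k : G) :
    Q.halfPairing (g + h) k = Q.halfPairing g k * Q.halfPairing h k := by
  rw [halfPairing, pairing_add_left, mul_pow]; rfl

theorem halfPairing_add_right (g h k : G) :
    Q.halfPairing g (h + k) = Q.halfPairing g h * Q.halfPairing g k := by
  rw [halfPairing, pairing_add_right, mul_pow]; rfl

theorem halfPairing_mul_conj (g h : G) : Q.halfPairing g h * conj (Q.halfPairing g h) = 1 := by
  rw [halfPairing, map_pow, ← mul_pow, pairing_mul_conj, one_pow]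

theorem pairing_pow_card (g h : G) : Q.pairing g h ^ Fintype.card G = 1 := by
  rw [← pairingChar_apply, ← AddChar.map_nsmul_eq_pow, card_nsmul_eq_zero,
    AddChar.map_zero_eq_one]

theorem halfPairing_sq (hG : Odd (Fintype.card G)) (g h : G) :
    Q.halfPairing g h ^ 2 = Q.pairing g h := by
  obtain ⟨k, hk⟩ := hG
  rw [halfPairing, ← pow_mul, show (Fintype.card G + 1) / 2 * 2 = Fintype.card G + 1 by omega,
    pow_succ, pairing_pow_card, one_mul]

/-- With n = |G|, both e(Q(g)) ^ (2n) and e(Q(g)) ^ (n²) = e(Q(ng)) are 1. For odd n the gcd of the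
exponents is n, so e(Q(g)) ^ (n + 1) = e(Q(g)). -/
theorem halfPairing_self (hG : Odd (Fintype.card G)) (g : G) :
    Q.halfPairing g g = qzExp (Q.toFun g) := by
  have h1 : qzExp (Q.toFun g) ^ (2 * Fintype.card G) = 1 := by
    rw [pow_mul, ← pairing_self, pairing_pow_card]
  have h2 : qzExp (Q.toFun g) ^ (Fintype.card G ^ 2) = 1 := by
    rw [← toFun_nsmul, card_nsmul_eq_zero, toFun_zero]
  obtain ⟨k, hk⟩ := hG
  have h3 : Fintype.card G ^ 2 = 2 * Fintype.card G * k + Fintype.card G := by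
    conv_lhs => rw [pow_two]; arg 2; rw [hk]
    ring
  rw [h3, pow_add, pow_mul, h1, one_pow, one_mul] at h2
  rw [halfPairing, pairing_self, ← pow_mul,
    show 2 * ((Fintype.card G + 1) / 2) = Fintype.card G + 1 by omega, pow_succ, h2, one_mul]

end NondegQuadForm

end Odd

/-! ### Sums over nonzero elements up to sign -/

section NonzeroUpToSign

variable {A : Type*} [AddCommGroup A]

/-- The class of a nonzero element. -/
def nzMk (p : A) (hp : p ≠ 0) : NonzeroUpToSign A := Quotient.mk (signSetoid A) ⟨p, hp⟩

theorem nzMk_surj (x : NonzeroUpToSign A) : ∃ p hp, x = nzMk p hp := by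
  induction x using Quotient.inductionOn with
  | h p => exact ⟨p.1, p.2, rfl⟩

theorem nzMk_eq_iff {p q : A} {hp : p ≠ 0} {hq : q ≠ 0} :
    nzMk p hp = nzMk q hq ↔ p = q ∨ p = -q :=
  Quotient.eq (r := signSetoid A)

variable [Fintype A]

section Cos

variable (Q : NondegQuadForm A)

theorem signCos_mk (p q : A) (hp : p ≠ 0) (hq : q ≠ 0) :
    signCos Q (nzMk p hp) (nzMk q hq) = Q.cosPairing p q := rfl

theorem signCos_comm (x y : NonzeroUpToSign A) : signCos Q x y = signCos Q y x := by
  obtain ⟨p, hp, rfl⟩ := nzMk_surj x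
  obtain ⟨q, hq, rfl⟩ := nzMk_surj y
  rw [signCos_mk, signCos_mk, NondegQuadForm.cosPairing, Q.halfPairing_comm]
  rfl

theorem cosPairing_eq (hA : Odd (Fintype.card A)) (p q : A) :
    Q.cosPairing p q = Q.pairing p q + conj (Q.pairing p q) := by
  rw [NondegQuadForm.cosPairing, ← map_pow, Q.halfPairing_sq hA]

/-- `p ↦ ⟨k, p⟩² + conj ⟨k, p⟩²` as a function of `p` up to sign. -/
noncomputable def cosLift (k : A) (x : NonzeroUpToSign A) : ℂ :=
  Quotient.lift (s := signSetoid A) (fun γ => Q.cosPairing k (γ : A)) (by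
    rintro x y (h | h) <;> simp only [h, Q.cosPairing_neg_right]) x

theorem cosLift_mk (k p : A) (hp : p ≠ 0) : cosLift Q k (nzMk p hp) = Q.cosPairing k p := rfl

theorem signCos_mk_left (k : A) (hk : k ≠ 0) (x : NonzeroUpToSign A) :
    signCos Q (nzMk k hk) x = cosLift Q k x := by
  obtain ⟨p, hp, rfl⟩ := nzMk_surj x
  rfl

theorem cosLift_zero (x : NonzeroUpToSign A) : cosLift Q 0 x = 2 := by
  obtain ⟨p, hp, rfl⟩ := nzMk_surj x
  rw [cosLift_mk, NondegQuadForm.cosPairing, NondegQuadForm.halfPairing]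
  norm_num

theorem cosLift_mul (k l : A) (x : NonzeroUpToSign A) :
    cosLift Q k x * cosLift Q l x = cosLift Q (k + l) x + cosLift Q (k - l) x := by
  obtain ⟨p, hp, rfl⟩ := nzMk_surj x
  simp only [cosLift_mk, NondegQuadForm.cosPairing, sub_eq_add_neg, Q.halfPairing_add_left,
    Q.halfPairing_neg_left, map_mul, Complex.conj_conj]
  ring

theorem signTwist_mk (hA : Odd (Fintype.card A)) (p : A) (hp : p ≠ 0) :
    signTwist Q (nzMk p hp) = qzExp (Q.toFun p) := Q.halfPairing_self hA p

end Cos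

variable [DecidableEq A]

/-- Oddness rules out p = -p for nonzero p, so every fibre of the sign quotient has exactly two
elements. -/
theorem sum_eq_add_sum_nonzeroUpToSign (hA : Odd (Fintype.card A)) (F : A → ℂ)
    (f : NonzeroUpToSign A → ℂ) (h : ∀ p hp, F p + F (-p) = f (nzMk p hp)) :
    ∑ k, F k = F 0 + ∑ x, f x := by
  rw [← Finset.add_sum_erase _ F (Finset.mem_univ 0)]
  congr 1
  have h1 : ∑ k ∈ Finset.univ.erase 0, F k = ∑ k : {k : A // k ≠ 0}, F k :=
    Finset.sum_subtype _ (by simp) F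
  rw [h1, ← Finset.sum_fiberwise (g := fun k : {k : A // k ≠ 0} => nzMk k.1 k.2)]
  refine Finset.sum_congr rfl fun x _ => ?_
  obtain ⟨p, hp, rfl⟩ := nzMk_surj x
  have hne : (⟨p, hp⟩ : {k : A // k ≠ 0}) ≠ ⟨-p, neg_ne_zero.2 hp⟩ := by
    intro h
    have h2 : p = -p := congrArg Subtype.val h
    exact hp (eq_zero_of_add_self_of_odd hA (eq_neg_iff_add_eq_zero.1 h2))
  have h2 : (Finset.univ.filter fun k : {k : A // k ≠ 0} => nzMk k.1 k.2 = nzMk p hp) =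
      {⟨p, hp⟩, ⟨-p, neg_ne_zero.2 hp⟩} := by
    ext k
    simp [nzMk_eq_iff, Subtype.ext_iff]
  rw [h2, Finset.sum_pair hne, h]

theorem two_mul_card_nonzeroUpToSign (hA : Odd (Fintype.card A)) :
    2 * Fintype.card (NonzeroUpToSign A) + 1 = Fintype.card A := by
  have h := sum_eq_add_sum_nonzeroUpToSign hA (fun _ => 1) (fun _ => 2) (fun _ _ => by norm_num)
  simp only [Finset.sum_const, Finset.card_univ, nsmul_eq_mul, mul_one] at h
  have h2 : ((2 * Fintype.card (NonzeroUpToSign A) + 1 : ℕ) : ℂ) = Fintype.card A := by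
    rw [h]; push_cast; ring
  exact_mod_cast h2

variable (Q : NondegQuadForm A)

theorem sum_cosLift (hA : Odd (Fintype.card A)) (k : A) :
    ∑ x, cosLift Q k x = if k = 0 then (Fintype.card A : ℂ) - 1 else -1 := by
  have h := sum_eq_add_sum_nonzeroUpToSign hA (fun p => Q.pairing k p) (cosLift Q k) (by
    intro p hp
    rw [cosLift_mk, cosPairing_eq Q hA, Q.pairing_neg_right])
  rw [Q.sum_pairing, Q.pairing_zero_right] at h
  split_ifs at h ⊢ <;> linear_combination -h

theorem sum_signCos (hA : Odd (Fintype.card A)) (x : NonzeroUpToSign A) :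
    ∑ y, signCos Q x y = -1 := by
  obtain ⟨p, hp, rfl⟩ := nzMk_surj x
  simp only [signCos_mk_left, sum_cosLift Q hA, if_neg hp]

/-- N counts which of p + q, p - q vanish. Both vanishing would give 2p = 0. -/
theorem sum_signCos_mul (hA : Odd (Fintype.card A)) (x y : NonzeroUpToSign A) :
    ∃ N : ℕ, N ≤ 1 ∧ ∑ z, signCos Q x z * signCos Q y z = (Fintype.card A : ℂ) * N - 2 := by
  obtain ⟨p, hp, rfl⟩ := nzMk_surj x
  obtain ⟨q, hq, rfl⟩ := nzMk_surj y
  simp only [signCos_mk_left, cosLift_mul, Finset.sum_add_distrib, sum_cosLift Q hA]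
  have hne : ¬ (p + q = 0 ∧ p - q = 0) := by
    rintro ⟨h1, h2⟩
    refine hp (eq_zero_of_add_self_of_odd hA ?_)
    rw [show p + p = (p + q) + (p - q) by abel, h1, h2, add_zero]
  by_cases h1 : p + q = 0 <;> by_cases h2 : p - q = 0
  · exact absurd ⟨h1, h2⟩ hne
  · exact ⟨1, le_rfl, by rw [if_pos h1, if_neg h2]; push_cast; ring⟩
  · exact ⟨1, le_rfl, by rw [if_neg h1, if_pos h2]; push_cast; ring⟩
  · exact ⟨0, zero_le_one, by rw [if_neg h1, if_neg h2]; push_cast; ring⟩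

/-- N counts the vanishing combinations p ± q ± r. Adding or subtracting two of them would give 2c =
0 with c one of the nonzero p, q, r. The bound on N is what later makes the fusion coefficients 1 -
N nonnegative. -/
theorem sum_signCos_mul_mul (hA : Odd (Fintype.card A)) (x y w : NonzeroUpToSign A) :
    ∃ N : ℕ, N ≤ 1 ∧ ∑ z, signCos Q x z * signCos Q y z * signCos Q w z =
      (Fintype.card A : ℂ) * N - 4 := by
  obtain ⟨p, hp, rfl⟩ := nzMk_surj x
  obtain ⟨q, hq, rfl⟩ := nzMk_surj y
  obtain ⟨r, hr, rfl⟩ := nzMk_surj w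
  simp only [signCos_mk_left, cosLift_mul, add_mul, Finset.sum_add_distrib, sum_cosLift Q hA]
  have h2 : ∀ {a b : A}, a = 0 → b = 0 → ∀ {c : A}, c ≠ 0 → c + c = a + b → False :=
    fun ha hb _ hc h => hc (eq_zero_of_add_self_of_odd hA (by rw [h, ha, hb, add_zero]))
  have h3 : ∀ {a b : A}, a = 0 → b = 0 → ∀ {c : A}, c ≠ 0 → c + c = a - b → False :=
    fun ha hb _ hc h => hc (eq_zero_of_add_self_of_odd hA (by rw [h, ha, hb, sub_zero]))
  by_cases e1 : p + q + r = 0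
  · have e2 : p + q - r ≠ 0 := fun e => h3 e1 e hr (by abel)
    have e3 : p - q + r ≠ 0 := fun e => h3 e1 e hq (by abel)
    have e4 : p - q - r ≠ 0 := fun e => h2 e1 e hp (by abel)
    exact ⟨1, le_rfl, by rw [if_pos e1, if_neg e2, if_neg e3, if_neg e4]; push_cast; ring⟩
  by_cases e2 : p + q - r = 0
  · have e3 : p - q + r ≠ 0 := fun e => h2 e2 e hp (by abel)
    have e4 : p - q - r ≠ 0 := fun e => h3 e2 e hq (by abel)
    exact ⟨1, le_rfl, by rw [if_neg e1, if_pos e2, if_neg e3, if_neg e4]; push_cast; ring⟩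
  by_cases e3 : p - q + r = 0
  · have e4 : p - q - r ≠ 0 := fun e => h3 e3 e hr (by abel)
    exact ⟨1, le_rfl, by rw [if_neg e1, if_neg e2, if_pos e3, if_neg e4]; push_cast; ring⟩
  by_cases e4 : p - q - r = 0
  · exact ⟨1, le_rfl, by rw [if_neg e1, if_neg e2, if_neg e3, if_pos e4]; push_cast; ring⟩
  · exact ⟨0, zero_le_one, by rw [if_neg e1, if_neg e2, if_neg e3, if_neg e4]; push_cast; ring⟩

end NonzeroUpToSign

/-! ### Transport of modular data -/

section Transport

variable {ι κ : Type*}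

theorem hasPosDims_submatrix_iff {S : Matrix κ κ ℂ} (E : ι ≃ κ) {e : ι} :
    HasPosDims (S.submatrix E E) e ↔ HasPosDims S (E e) :=
  E.forall_congr_left.trans (by simp [HasPosDims])

variable [Fintype ι] [Fintype κ]

theorem IsIdentityFor.submatrix {S : Matrix κ κ ℂ} (E : ι ≃ κ) {e : ι}
    (h : IsIdentityFor S (E e)) : IsIdentityFor (S.submatrix E E) e := by
  refine ⟨fun a => h.sq_pos (E a), fun a b c => ?_⟩
  obtain ⟨N, hN⟩ := h.verlinde (E a) (E b) (E c)
  exact ⟨N, by rw [← hN]; exact E.sum_comp (fun d => S (E a) d * S (E b) d * S (E c) d / S (E e) d)⟩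

theorem isIdentityFor_submatrix_iff {S : Matrix κ κ ℂ} (E : ι ≃ κ) {e : ι} :
    IsIdentityFor (S.submatrix E E) e ↔ IsIdentityFor S (E e) := by
  refine ⟨fun h => ?_, IsIdentityFor.submatrix E⟩
  have h2 : IsIdentityFor (S.submatrix E E) (E.symm (E e)) := by simpa using h
  simpa using h2.submatrix E.symm

variable [DecidableEq ι] [DecidableEq κ]

theorem IsModularData.submatrix {S T : Matrix κ κ ℂ} (E : ι ≃ κ) (h : IsModularData S T) :
    IsModularData (S.submatrix E E) (T.submatrix E E) := by
  have hu : ∀ {A : Matrix κ κ ℂ}, A ∈ Matrix.unitaryGroup κ ℂ →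
      A.submatrix E E ∈ Matrix.unitaryGroup ι ℂ := by
    intro A hA
    rw [Matrix.mem_unitaryGroup_iff, Matrix.star_eq_conjTranspose] at hA ⊢
    rw [Matrix.conjTranspose_submatrix, Matrix.submatrix_mul_equiv, hA,
      Matrix.submatrix_one_equiv]
  let f : Matrix κ κ ℂ →* Matrix ι ι ℂ := (Matrix.reindexAlgEquiv ℂ ℂ E.symm).toMonoidHom
  have hf : ∀ A, f A = A.submatrix E E := fun A => rfl
  refine ⟨hu h.unitary_S, hu h.unitary_T, h.symm_S.submatrix E, h.diag_T.submatrix E.injective,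
    f.isOfFinOrder h.finOrder_T, ?_, ?_⟩
  · obtain ⟨ρ, h1, h2⟩ := h.rep
    exact ⟨f.comp ρ, by simp [h1, hf], by simp [h2, hf]⟩
  · obtain ⟨e, he⟩ := h.identity
    exact ⟨E.symm e, IsIdentityFor.submatrix E (by simpa using he)⟩

theorem isModularData_submatrix_iff {S T : Matrix κ κ ℂ} (E : ι ≃ κ) :
    IsModularData (S.submatrix E E) (T.submatrix E E) ↔ IsModularData S T := by
  refine ⟨fun h => ?_, IsModularData.submatrix E⟩
  simpa using h.submatrix E.symm

omit [DecidableEq ι] [DecidableEq κ] in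
-- The Verlinde sum of a tensor product factors as the product of the two Verlinde sums.
theorem IsIdentityFor.kronecker {A : Matrix ι ι ℂ} {B : Matrix κ κ ℂ} {e : ι} {e' : κ}
    (hA : IsIdentityFor A e) (hB : IsIdentityFor B e') : IsIdentityFor (A ⊗ₖ B) (e, e') := by
  constructor
  · rintro ⟨a, b⟩
    obtain ⟨r, hr, h1⟩ := hA.sq_pos a
    obtain ⟨s, hs, h2⟩ := hB.sq_pos b
    refine ⟨r * s, mul_pos hr hs, ?_⟩
    rw [Matrix.kronecker_apply, mul_pow, h1, h2, Complex.ofReal_mul]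
  · rintro ⟨a, a'⟩ ⟨b, b'⟩ ⟨c, c'⟩
    obtain ⟨M, hM⟩ := hA.verlinde a b c
    obtain ⟨N, hN⟩ := hB.verlinde a' b' c'
    refine ⟨M * N, ?_⟩
    rw [Nat.cast_mul, ← hM, ← hN, Finset.sum_mul_sum, Fintype.sum_prod_type]
    refine Finset.sum_congr rfl fun d _ => Finset.sum_congr rfl fun d' _ => ?_
    simp only [Matrix.kronecker_apply]
    rw [div_mul_div_comm]
    congr 1
    ring

end Transport

section TwoForms

variable {G G' : Type*} [AddCommGroup G] [Fintype G] [AddCommGroup G'] [Fintype G']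

/-! ### The factor of the index set on which `G` acts trivially -/

/-- The classes of primaries under translation by `G`. -/
abbrev Neutral (G G' : Type*) [AddCommGroup G] [AddCommGroup G'] : Type _ :=
  Unit ⊕ Unit ⊕ NonzeroUpToSign G ⊕ NonzeroUpToSign G'

/-- The pair `{m + p, m - p}`. -/
def shiftedPair (m : G) (x : NonzeroUpToSign G) : Sym2 G :=
  Quotient.lift (s := signSetoid G) (fun p => s(m + (p : G), m - p)) (by
    rintro x y (h | h)
    · simp only [h]
    · simp only [h, sub_neg_eq_add, ← sub_eq_add_neg]
      exact Sym2.eq_swap) x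

omit [Fintype G] in
theorem shiftedPair_mk (m p : G) (hp : p ≠ 0) :
    shiftedPair m (nzMk p hp) = s(m + p, m - p) := rfl

theorem shiftedPair_not_isDiag (hG : Odd (Fintype.card G)) (m : G) (x : NonzeroUpToSign G) :
    ¬ (shiftedPair m x).IsDiag := by
  obtain ⟨p, hp, rfl⟩ := nzMk_surj x
  rw [shiftedPair_mk, Sym2.mk_isDiag_iff]
  intro h
  refine hp (eq_zero_of_add_self_of_odd hG ?_)
  rw [show p + p = (m + p) - (m - p) by abel, h, sub_self]

/-- The primary with given `G`-charge and class. -/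
def primaryOf (G' : Type*) [AddCommGroup G'] (hG : Odd (Fintype.card G)) :
    G × Neutral G G' → Primary G G'
  | (m, .inl _) => .inl m
  | (m, .inr (.inl _)) => .inr (.inl m)
  | (m, .inr (.inr (.inl x))) => .inr (.inr (.inl ⟨shiftedPair m x, shiftedPair_not_isDiag hG m x⟩))
  | (m, .inr (.inr (.inr y))) => .inr (.inr (.inr (m, y)))

omit [Fintype G'] in
-- In odd order halving is possible and unique: the pair {k, l} determines m by 2m = k + l, and then
-- p = k - m up to sign.
theorem primaryOf_bijective (hG : Odd (Fintype.card G)) :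
    Function.Bijective (primaryOf G' hG) := by
  constructor
  · rintro ⟨m, _ | _ | x | y⟩ ⟨m', _ | _ | x' | y'⟩ h <;> simp only [primaryOf, Sum.inl.injEq,
      Sum.inr.injEq, reduceCtorEq, Subtype.mk.injEq, Prod.mk.injEq] at h
    · rw [h]
    · rw [h]
    · obtain ⟨p, hp, rfl⟩ := nzMk_surj x
      obtain ⟨q, hq, rfl⟩ := nzMk_surj x'
      rw [shiftedPair_mk, shiftedPair_mk, Sym2.eq_iff] at h
      have hm : m = m' := by
        rw [← sub_eq_zero]
        apply eq_zero_of_add_self_of_odd hG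
        rw [show m - m' + (m - m') = (m + p) + (m - p) - ((m' + q) + (m' - q)) by abel]
        rcases h with ⟨h1, h2⟩ | ⟨h1, h2⟩ <;> rw [h1, h2] <;> abel
      subst hm
      congr 4
      rw [nzMk_eq_iff]
      rcases h with ⟨h1, -⟩ | ⟨h1, -⟩
      · exact Or.inl (add_left_cancel h1)
      · rw [sub_eq_add_neg] at h1
        exact Or.inr (add_left_cancel h1)
    · rw [h.1, h.2]
  · rintro (g | h | ⟨z, hz⟩ | ⟨m, y⟩)
    · exact ⟨(g, .inl ()), rfl⟩
    · exact ⟨(h, .inr (.inl ())), rfl⟩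
    · induction z using Sym2.inductionOn with
      | hf k l =>
        obtain ⟨m, hm⟩ := exists_add_self_of_odd hG (k + l)
        have hk : k - m ≠ 0 := by
          intro h
          have h1 : k = m := sub_eq_zero.1 h
          have h2 : k = l := by rw [← h1] at hm; exact add_left_cancel hm
          exact hz (Sym2.mk_isDiag_iff.2 h2)
        refine ⟨(m, .inr (.inr (.inl (nzMk (k - m) hk)))), ?_⟩
        have h1 : m + (k - m) = k := by abel
        have h2 : m - (k - m) = l := by rw [show m - (k - m) = (m + m) - k by abel, hm]; abel
        simp only [primaryOf, shiftedPair_mk, h1, h2]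
    · exact ⟨(m, .inr (.inr (.inr y))), rfl⟩

/-- Primaries correspond to pairs of a `G`-charge and a class. -/
noncomputable def primaryEquiv (G' : Type*) [AddCommGroup G'] (hG : Odd (Fintype.card G)) :
    G × Neutral G G' ≃ Primary G G' := Equiv.ofBijective _ (primaryOf_bijective hG)

theorem card_primary [DecidableEq G] [DecidableEq G'] {n : ℕ} (hn : Odd n)
    (hG : Fintype.card G = n) (hG' : Fintype.card G' = n + 4) :
    Fintype.card (Primary G G') = n * (n + 3) := by
  have h1 := two_mul_card_nonzeroUpToSign (A := G) (hG ▸ hn)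
  have h2 := two_mul_card_nonzeroUpToSign (A := G') (by
    rw [hG']; exact hn.add_even (by decide))
  rw [← Fintype.card_congr (primaryEquiv G' (hG ▸ hn)), Fintype.card_prod, Fintype.card_sum,
    Fintype.card_sum, Fintype.card_sum, Fintype.card_unit, hG]
  congr 1
  omega

/-! ### Numerical identities -/

theorem delta_sq (n : ℕ) : delta n ^ 2 = n * (delta n + 1) := by
  have h : Real.sqrt ((n : ℝ) ^ 2 + 4 * n) ^ 2 = (n : ℝ) ^ 2 + 4 * n := Real.sq_sqrt (by positivity)
  simp only [delta]
  linear_combination h / 4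

theorem delta_pos {n : ℕ} (hn : 0 < n) : 0 < delta n := by
  have h : (0 : ℝ) < n := by exact_mod_cast hn
  have := Real.sqrt_nonneg ((n : ℝ) ^ 2 + 4 * n)
  simp only [delta]
  linarith

theorem lam_eq (n : ℕ) : lam n = n * (delta n + 2) := by
  rw [lam, delta_sq]; ring

/-- The normalization `√n / λ`. -/
noncomputable def kap (n : ℕ) : ℝ := Real.sqrt n / lam n

theorem kap_pos {n : ℕ} (hn : 0 < n) : 0 < kap n := by
  have h : (0 : ℝ) < n := by exact_mod_cast hn
  have hd := delta_pos hn
  have hs := Real.sqrt_pos.2 h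
  rw [kap, lam_eq]
  positivity

theorem kap_mul_delta_add_two {n : ℕ} (hn : 0 < n) :
    kap n * (delta n + 2) = 1 / Real.sqrt n := by
  have h : (0 : ℝ) < n := by exact_mod_cast hn
  have hd := delta_pos hn
  have hs := Real.sqrt_pos.2 h
  have h2 := Real.mul_self_sqrt h.le
  rw [kap, lam_eq]
  field_simp
  linear_combination h2

/-- From δ² = n(δ + 1) one gets (n + 4)δ² = n(δ + 2)². This is what singles out the order n + 4 for
the second group. -/
theorem kap_mul_delta {n : ℕ} (hn : 0 < n) :
    kap n * delta n = 1 / Real.sqrt ((n + 4 : ℕ) : ℝ) := by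
  have h : (0 : ℝ) < n := by exact_mod_cast hn
  have h' : (0 : ℝ) < ((n + 4 : ℕ) : ℝ) := by positivity
  have hd := delta_pos hn
  have hs := Real.sqrt_pos.2 h'
  have hk := kap_pos hn
  rw [eq_div_iff hs.ne', ← pow_eq_one_iff_of_nonneg (by positivity) two_ne_zero, mul_pow,
    Real.sq_sqrt h'.le]
  have h1 : (kap n * (delta n + 2)) ^ 2 * n = 1 := by
    rw [kap_mul_delta_add_two hn, div_pow, Real.sq_sqrt h.le]
    field_simp
  have h2 := delta_sq n
  rw [← h1]
  push_cast
  linear_combination (4 * kap n ^ 2) * h2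

/-! ### Factorization of the modular data -/

variable (Q : NondegQuadForm G) (Q' : NondegQuadForm G')

/-- The entries of the second tensor factor of `S`, up to normalization. -/
noncomputable def coreEntry : Neutral G G' → Neutral G G' → ℂ :=
  let δ : ℂ := (delta (Fintype.card G) : ℂ)
  fun
  | .inl _, .inl _ => 1
  | .inl _, .inr (.inl _) => δ + 1
  | .inl _, .inr (.inr (.inl _)) => δ + 2
  | .inl _, .inr (.inr (.inr _)) => δ
  | .inr (.inl _), .inl _ => δ + 1
  | .inr (.inl _), .inr (.inl _) => 1
  | .inr (.inl _), .inr (.inr (.inl _)) => δ + 2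
  | .inr (.inl _), .inr (.inr (.inr _)) => -δ
  | .inr (.inr (.inl _)), .inl _ => δ + 2
  | .inr (.inr (.inl _)), .inr (.inl _) => δ + 2
  | .inr (.inr (.inl x)), .inr (.inr (.inl x')) => (δ + 2) * signCos Q x x'
  | .inr (.inr (.inl _)), .inr (.inr (.inr _)) => 0
  | .inr (.inr (.inr _)), .inl _ => δ
  | .inr (.inr (.inr _)), .inr (.inl _) => -δ
  | .inr (.inr (.inr _)), .inr (.inr (.inl _)) => 0
  | .inr (.inr (.inr y)), .inr (.inr (.inr y')) => -δ * signCos Q' y y'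

/-- The second tensor factor of `S`. -/
noncomputable def coreS : Matrix (Neutral G G') (Neutral G G') ℂ :=
  Matrix.of fun x y => (kap (Fintype.card G) : ℂ) * coreEntry Q Q' x y

/-- The diagonal entries of the second tensor factor of `T`. -/
noncomputable def coreT : Neutral G G' → ℂ
  | .inl _ => 1
  | .inr (.inl _) => 1
  | .inr (.inr (.inl x)) => conj (signTwist Q x)
  | .inr (.inr (.inr y)) => signTwist Q' y

theorem entryS_primaryOf (hG : Odd (Fintype.card G)) (m m' : G) (x x' : Neutral G G') :
    entryS Q Q' (primaryOf G' hG (m, x)) (primaryOf G' hG (m', x')) =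
      conj (Q.pairing m m') * coreEntry Q Q' x x' := by
  have hsq : ∀ a b, conj (Q.halfPairing a b) ^ 2 = conj (Q.pairing a b) := fun a b => by
    rw [← map_pow, Q.halfPairing_sq hG]
  have hsum : ∀ (a : G) (y : NonzeroUpToSign G), pairSum (shiftedPair a y) = a + a := by
    intro a y
    obtain ⟨p, hp, rfl⟩ := nzMk_surj y
    exact show a + p + (a - p) = a + a by abel
  have hdr : ∀ a b, conj (Q.halfPairing a (b + b)) = conj (Q.pairing a b) := fun a b => by
    rw [Q.halfPairing_add_right, ← pow_two, Q.halfPairing_sq hG]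
  have hdl : ∀ a b, conj (Q.halfPairing (a + a) b) = conj (Q.pairing a b) := fun a b => by
    rw [Q.halfPairing_add_left, ← pow_two, Q.halfPairing_sq hG]
  have hpp : ∀ (a b : G) (y z : NonzeroUpToSign G),
      pairPair Q (shiftedPair a y) (shiftedPair b z) = conj (Q.pairing a b) * signCos Q y z := by
    intro a b y z
    obtain ⟨p, hp, rfl⟩ := nzMk_surj y
    obtain ⟨q, hq, rfl⟩ := nzMk_surj z
    have e1 := Q.halfPairing_mul_conj a q
    have e2 := Q.halfPairing_mul_conj p b
    rw [shiftedPair_mk, shiftedPair_mk, pairPair, Sym2.lift₂_mk, signCos_mk, ← hsq,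
      NondegQuadForm.cosPairing]
    simp only [sub_eq_add_neg, Q.halfPairing_add_left, Q.halfPairing_add_right,
      Q.halfPairing_neg_left, Q.halfPairing_neg_right, map_mul, Complex.conj_conj]
    generalize Q.halfPairing a q = u at *
    generalize Q.halfPairing p b = v at *
    generalize conj u = u' at *
    generalize conj v = v' at *
    generalize conj (Q.halfPairing a b) = w
    generalize Q.halfPairing p q = t
    generalize conj t = t'
    -- In both products the cross terms ⟨a, q⟩ and ⟨p, b⟩ appear together with their conjugates and
    -- cancel.
    linear_combination (w ^ 2 * (t ^ 2 + t' ^ 2) * v * v') * e1 + (w ^ 2 * (t ^ 2 + t' ^ 2)) * e2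
  rcases x with _ | _ | x | y <;> rcases x' with _ | _ | x' | y' <;>
    simp only [primaryOf, entryS, coreEntry, hsq, hsum, hdr, hdl, hpp] <;> ring

/-- For pairs, ⟨m + p, m - p⟩ = ⟨m, m⟩ conj ⟨p, p⟩: the conjugate is the reason the core involves -Q
rather than Q. -/
theorem entryT_primaryOf (hG : Odd (Fintype.card G)) (m : G) (x : Neutral G G') :
    entryT Q Q' (primaryOf G' hG (m, x)) = 1 * qzExp (Q.toFun m) * coreT Q Q' x := by
  rcases x with _ | _ | x | y
  · simp [primaryOf, entryT, coreT, Q.halfPairing_self hG]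
  · simp [primaryOf, entryT, coreT, Q.halfPairing_self hG]
  · obtain ⟨p, hp, rfl⟩ := nzMk_surj x
    have e := Q.halfPairing_mul_conj m p
    simp only [primaryOf, entryT, coreT, shiftedPair_mk, pairTwist, Sym2.lift_mk,
      signTwist_mk Q hG]
    rw [← Q.halfPairing_self hG, ← Q.halfPairing_self hG]
    simp only [sub_eq_add_neg, Q.halfPairing_add_left, Q.halfPairing_add_right,
      Q.halfPairing_neg_right]
    rw [Q.halfPairing_comm p m]
    linear_combination (Q.halfPairing m m * conj (Q.halfPairing p p)) * e
  · simp [primaryOf, entryT, coreT, Q.halfPairing_self hG]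

theorem doubleS_submatrix (hG : Odd (Fintype.card G)) :
    (doubleS Q Q').submatrix (primaryEquiv G' hG) (primaryEquiv G' hG) =
      weilS Q 1 ⊗ₖ coreS Q Q' := by
  ext ⟨m, x⟩ ⟨m', x'⟩
  have h := entryS_primaryOf Q Q' hG m m' x x'
  have h0 := sqrt_card_ne_zero (G := G)
  rw [Matrix.kronecker_apply, Matrix.submatrix_apply, doubleS, Matrix.of_apply]
  change _ * entryS Q Q' (primaryOf G' hG (m, x)) (primaryOf G' hG (m', x')) = _
  rw [h]
  simp only [weilS, coreS, Matrix.of_apply, kap, Complex.ofReal_div]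
  field_simp

variable [DecidableEq G] [DecidableEq G']

theorem doubleT_submatrix (hG : Odd (Fintype.card G)) :
    (doubleT Q Q').submatrix (primaryEquiv G' hG) (primaryEquiv G' hG) =
      weilT Q 1 ⊗ₖ Matrix.diagonal (coreT Q Q') := by
  rw [doubleT, weilT, Matrix.diagonal_kronecker_diagonal,
    Matrix.submatrix_diagonal_equiv]
  congr 1
  funext ⟨m, x⟩
  exact entryT_primaryOf Q Q' hG m x

end TwoForms

/-! ### The core as Weil representations on even functions -/

section Intertwiners

variable {G G' : Type*} [AddCommGroup G] [Fintype G] [AddCommGroup G'] [Fintype G']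
  [DecidableEq G] [DecidableEq G']

/-- Vectors on classes as even functions on `G`. -/
def evenLeft (v : Neutral G G' → ℂ) (g : G) : ℂ :=
  if h : g = 0 then v (.inl ()) + v (.inr (.inl ())) else v (.inr (.inr (.inl (nzMk g h))))

/-- Vectors on classes as even functions on `G'`. -/
def evenRight (v : Neutral G G' → ℂ) (g : G') : ℂ :=
  if h : g = 0 then v (.inr (.inl ())) - v (.inl ()) else v (.inr (.inr (.inr (nzMk g h))))

omit [Fintype G] [Fintype G'] [DecidableEq G'] in
theorem evenLeft_zero (v : Neutral G G' → ℂ) :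
    evenLeft v 0 = v (.inl ()) + v (.inr (.inl ())) := dif_pos rfl

omit [Fintype G] [Fintype G'] [DecidableEq G'] in
theorem evenLeft_of_ne (v : Neutral G G' → ℂ) {g : G} (h : g ≠ 0) :
    evenLeft v g = v (.inr (.inr (.inl (nzMk g h)))) := dif_neg h

omit [Fintype G] [Fintype G'] [DecidableEq G] in
theorem evenRight_zero (v : Neutral G G' → ℂ) :
    evenRight v 0 = v (.inr (.inl ())) - v (.inl ()) := dif_pos rfl

omit [Fintype G] [Fintype G'] [DecidableEq G] in
theorem evenRight_of_ne (v : Neutral G G' → ℂ) {g : G'} (h : g ≠ 0) :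
    evenRight v g = v (.inr (.inr (.inr (nzMk g h)))) := dif_neg h

omit [Fintype G] [Fintype G'] [DecidableEq G'] in
theorem evenLeft_neg (v : Neutral G G' → ℂ) (g : G) : evenLeft v (-g) = evenLeft v g := by
  by_cases h : g = 0
  · rw [h, neg_zero]
  · rw [evenLeft_of_ne v h, evenLeft_of_ne v (neg_ne_zero.2 h)]
    exact congrArg (fun x => v (.inr (.inr (.inl x)))) (nzMk_eq_iff.2 (Or.inr rfl))

omit [Fintype G] [Fintype G'] [DecidableEq G] in
theorem evenRight_neg (v : Neutral G G' → ℂ) (g : G') : evenRight v (-g) = evenRight v g := by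
  by_cases h : g = 0
  · rw [h, neg_zero]
  · rw [evenRight_of_ne v h, evenRight_of_ne v (neg_ne_zero.2 h)]
    exact congrArg (fun x => v (.inr (.inr (.inr x)))) (nzMk_eq_iff.2 (Or.inr rfl))

omit [Fintype G] [Fintype G'] in
-- The two values at 0 are the sum and the difference of the first two coordinates, which recover
-- both. Matrix identities for the core can thus be checked on G and on G' separately.
theorem eq_of_evenLeft_evenRight {v w : Neutral G G' → ℂ} (hl : evenLeft v = evenLeft w)
    (hr : evenRight v = evenRight w) : v = w := by
  have h1 := congrFun hl 0
  have h2 := congrFun hr 0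
  rw [evenLeft_zero, evenLeft_zero] at h1
  rw [evenRight_zero, evenRight_zero] at h2
  funext x
  rcases x with ⟨⟩ | ⟨⟩ | x | y
  · linear_combination (h1 - h2) / 2
  · linear_combination (h1 + h2) / 2
  · obtain ⟨p, hp, rfl⟩ := nzMk_surj x
    rw [← evenLeft_of_ne v, ← evenLeft_of_ne w, hl]
  · obtain ⟨p, hp, rfl⟩ := nzMk_surj y
    rw [← evenRight_of_ne v, ← evenRight_of_ne w, hr]

variable (Q : NondegQuadForm G) (Q' : NondegQuadForm G')

omit [Fintype G'] [DecidableEq G'] in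
theorem weilS_mulVec_evenLeft (hG : Odd (Fintype.card G)) (v : Neutral G G' → ℂ) (g : G) :
    (weilS Q.neg 1).mulVec (evenLeft v) g = 1 / (Real.sqrt (Fintype.card G) : ℂ) *
      (v (.inl ()) + v (.inr (.inl ())) + ∑ x, cosLift Q g x * v (.inr (.inr (.inl x)))) := by
  have h := sum_eq_add_sum_nonzeroUpToSign hG (fun k => Q.pairing g k * evenLeft v k)
    (fun x => cosLift Q g x * v (.inr (.inr (.inl x)))) (by
      intro p hp
      rw [cosLift_mk, cosPairing_eq Q hG, evenLeft_neg, evenLeft_of_ne v hp, Q.pairing_neg_right]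
      ring)
  rw [Q.pairing_zero_right, one_mul, evenLeft_zero] at h
  rw [← h, Matrix.mulVec, dotProduct, Finset.mul_sum]
  refine Finset.sum_congr rfl fun k _ => ?_
  rw [weilS, Matrix.of_apply, Q.neg_pairing, Complex.conj_conj, mul_assoc]

omit [Fintype G] [DecidableEq G] in
theorem weilS_mulVec_evenRight (hG' : Odd (Fintype.card G')) (v : Neutral G G' → ℂ) (g : G') :
    (weilS Q' (-1)).mulVec (evenRight v) g = 1 / (Real.sqrt (Fintype.card G') : ℂ) *
      (v (.inl ()) - v (.inr (.inl ())) - ∑ x, cosLift Q' g x * v (.inr (.inr (.inr x)))) := by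
  have h := sum_eq_add_sum_nonzeroUpToSign hG' (fun k => conj (Q'.pairing g k) * evenRight v k)
    (fun x => cosLift Q' g x * v (.inr (.inr (.inr x)))) (by
      intro p hp
      rw [cosLift_mk, cosPairing_eq Q' hG', evenRight_neg, evenRight_of_ne v hp,
        Q'.pairing_neg_right, Complex.conj_conj]
      ring)
  rw [Q'.pairing_zero_right, map_one, one_mul, evenRight_zero] at h
  have h2 : (weilS Q' (-1)).mulVec (evenRight v) g = -1 / (Real.sqrt (Fintype.card G') : ℂ) *
      ∑ k, conj (Q'.pairing g k) * evenRight v k := by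
    rw [Matrix.mulVec, dotProduct, Finset.mul_sum]
    refine Finset.sum_congr rfl fun k _ => ?_
    rw [weilS, Matrix.of_apply, mul_assoc]
  rw [h2, h]
  ring

theorem coreS_mulVec (v : Neutral G G' → ℂ) (x : Neutral G G') :
    (coreS Q Q').mulVec v x = (kap (Fintype.card G) : ℂ) *
      (coreEntry Q Q' x (.inl ()) * v (.inl ()) +
        (coreEntry Q Q' x (.inr (.inl ())) * v (.inr (.inl ())) +
        (∑ y, coreEntry Q Q' x (.inr (.inr (.inl y))) * v (.inr (.inr (.inl y))) +
        ∑ y, coreEntry Q Q' x (.inr (.inr (.inr y))) * v (.inr (.inr (.inr y)))))) := by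
  simp only [Matrix.mulVec, dotProduct, coreS, Matrix.of_apply, mul_assoc, ← Finset.mul_sum,
    Fintype.sum_sum_type, Finset.univ_unique, Finset.sum_singleton, PUnit.default_eq_unit]

/-- Adding the first two rows cancels the terms from G' and leaves the common coefficient δ + 2,
which the normalization turns into 1/√|G|. -/
theorem evenLeft_coreS (hG : Odd (Fintype.card G)) (v : Neutral G G' → ℂ) :
    evenLeft ((coreS Q Q').mulVec v) = (weilS Q.neg 1).mulVec (evenLeft v) := by
  have hk := congrArg Complex.ofReal (kap_mul_delta_add_two hG.pos)
  push_cast at hk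
  funext g
  rw [weilS_mulVec_evenLeft Q hG, ← hk]
  by_cases h : g = 0
  · rw [h, evenLeft_zero, coreS_mulVec, coreS_mulVec]
    simp only [coreEntry, cosLift_zero, ← Finset.mul_sum]
    ring
  · rw [evenLeft_of_ne _ h, coreS_mulVec]
    simp only [coreEntry, signCos_mk_left, mul_assoc, ← Finset.mul_sum, zero_mul,
      Finset.sum_const_zero]
    ring

/-- Subtracting the first row from the second cancels the terms from G and leaves the common
coefficient δ, normalized to 1/√|G'|. The overall sign is absorbed in α = -1. -/
theorem evenRight_coreS (hG : 0 < Fintype.card G) (hG' : Odd (Fintype.card G'))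
    (hc : Fintype.card G' = Fintype.card G + 4) (v : Neutral G G' → ℂ) :
    evenRight ((coreS Q Q').mulVec v) = (weilS Q' (-1)).mulVec (evenRight v) := by
  have hk := congrArg Complex.ofReal (kap_mul_delta hG)
  rw [← hc] at hk
  simp only [Complex.ofReal_mul, Complex.ofReal_div, Complex.ofReal_one] at hk
  funext g
  rw [weilS_mulVec_evenRight Q' hG', ← hk]
  by_cases h : g = 0
  · rw [h, evenRight_zero, coreS_mulVec, coreS_mulVec]
    simp only [coreEntry, cosLift_zero, ← Finset.mul_sum]
    ring
  · rw [evenRight_of_ne _ h, coreS_mulVec]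
    simp only [coreEntry, signCos_mk_left, mul_assoc, ← Finset.mul_sum, zero_mul,
      Finset.sum_const_zero]
    ring

theorem evenLeft_coreT (hG : Odd (Fintype.card G)) (v : Neutral G G' → ℂ) :
    evenLeft ((Matrix.diagonal (coreT Q Q')).mulVec v) =
      (weilT Q.neg 1).mulVec (evenLeft v) := by
  funext g
  rw [weilT, Matrix.mulVec_diagonal, one_mul, Q.qzExp_neg_toFun]
  by_cases h : g = 0
  · rw [h, evenLeft_zero, evenLeft_zero, Q.toFun_zero, Matrix.mulVec_diagonal,
      Matrix.mulVec_diagonal]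
    simp [coreT]
  · rw [evenLeft_of_ne _ h, evenLeft_of_ne _ h, Matrix.mulVec_diagonal, coreT,
      signTwist_mk Q hG]

theorem evenRight_coreT (hG' : Odd (Fintype.card G')) (v : Neutral G G' → ℂ) :
    evenRight ((Matrix.diagonal (coreT Q Q')).mulVec v) =
      (weilT Q' 1).mulVec (evenRight v) := by
  funext g
  rw [weilT, Matrix.mulVec_diagonal, one_mul]
  by_cases h : g = 0
  · rw [h, evenRight_zero, evenRight_zero, Q'.toFun_zero, Matrix.mulVec_diagonal,
      Matrix.mulVec_diagonal]
    simp [coreT]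
  · rw [evenRight_of_ne _ h, evenRight_of_ne _ h, Matrix.mulVec_diagonal, coreT,
      signTwist_mk Q' hG']

omit [Fintype G'] [DecidableEq G'] in
theorem weilS_sq_mulVec_evenLeft (P : NondegQuadForm G) (v : Neutral G G' → ℂ) :
    (weilS P 1 ^ 2).mulVec (evenLeft v) = evenLeft v := by
  funext g
  rw [pow_two, weilS_mul_self, Matrix.mulVec, dotProduct, Finset.sum_eq_single (-g)]
  · simp [evenLeft_neg]
  · intro k _ hk
    have : g + k ≠ 0 := fun h => hk (neg_eq_of_add_eq_zero_right h).symm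
    simp [this]
  · simp

omit [Fintype G] [DecidableEq G] in
theorem weilS_sq_mulVec_evenRight (P : NondegQuadForm G') (v : Neutral G G' → ℂ) :
    (weilS P (-1) ^ 2).mulVec (evenRight v) = evenRight v := by
  funext g
  rw [pow_two, weilS_mul_self, Matrix.mulVec, dotProduct, Finset.sum_eq_single (-g)]
  · simp [evenRight_neg]
  · intro k _ hk
    have : g + k ≠ 0 := fun h => hk (neg_eq_of_add_eq_zero_right h).symm
    simp [this]
  · simp

theorem coreS_mul_self (hG : Odd (Fintype.card G)) (hG' : Odd (Fintype.card G'))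
    (hc : Fintype.card G' = Fintype.card G + 4) : coreS Q Q' * coreS Q Q' = 1 := by
  apply Matrix.mulVec_injective
  funext v
  rw [Matrix.one_mulVec, ← Matrix.mulVec_mulVec]
  apply eq_of_evenLeft_evenRight
  · rw [evenLeft_coreS Q Q' hG, evenLeft_coreS Q Q' hG, Matrix.mulVec_mulVec, ← pow_two,
      weilS_sq_mulVec_evenLeft]
  · rw [evenRight_coreS Q Q' hG.pos hG' hc, evenRight_coreS Q Q' hG.pos hG' hc,
      Matrix.mulVec_mulVec, ← pow_two, weilS_sq_mulVec_evenRight]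

theorem evenLeft_core_cube (hG : Odd (Fintype.card G)) (v : Neutral G G' → ℂ) :
    evenLeft (((coreS Q Q' * Matrix.diagonal (coreT Q Q')) ^ 3).mulVec v) =
      conj (Q.gaussSum 1) • evenLeft v := by
  have h : ∀ v, evenLeft ((coreS Q Q' * Matrix.diagonal (coreT Q Q')).mulVec v) =
      (weilS Q.neg 1 * weilT Q.neg 1).mulVec (evenLeft v) := by
    intro v
    rw [← Matrix.mulVec_mulVec, evenLeft_coreS Q Q' hG, evenLeft_coreT Q Q' hG,
      Matrix.mulVec_mulVec]
  have h3 := congrArg (fun M => Matrix.mulVec M (evenLeft v)) (weil_cube Q.neg 1 1)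
  simp only [Matrix.smul_mulVec, weilS_sq_mulVec_evenLeft, one_pow, one_mul, Q.neg_gaussSum] at h3
  rw [← h3]
  simp only [pow_succ, pow_zero, one_mul, ← Matrix.mulVec_mulVec _ (_ * _), h]

theorem evenRight_core_cube (hG : Odd (Fintype.card G)) (hG' : Odd (Fintype.card G'))
    (hc : Fintype.card G' = Fintype.card G + 4) (v : Neutral G G' → ℂ) :
    evenRight (((coreS Q Q' * Matrix.diagonal (coreT Q Q')) ^ 3).mulVec v) =
      (-Q'.gaussSum 1) • evenRight v := by
  have h : ∀ v, evenRight ((coreS Q Q' * Matrix.diagonal (coreT Q Q')).mulVec v) =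
      (weilS Q' (-1) * weilT Q' 1).mulVec (evenRight v) := by
    intro v
    rw [← Matrix.mulVec_mulVec, evenRight_coreS Q Q' hG.pos hG' hc, evenRight_coreT Q Q' hG',
      Matrix.mulVec_mulVec]
  have h3 := congrArg (fun M => Matrix.mulVec M (evenRight v)) (weil_cube Q' (-1) 1)
  simp only [Matrix.smul_mulVec, weilS_sq_mulVec_evenRight, one_pow, mul_one, neg_mul,
    one_mul] at h3
  rw [← h3]
  simp only [pow_succ, pow_zero, one_mul, ← Matrix.mulVec_mulVec _ (_ * _), h]

theorem smul_core_cube_eq_one_iff (hG : Odd (Fintype.card G)) (hG' : Odd (Fintype.card G'))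
    (hc : Fintype.card G' = Fintype.card G + 4) :
    Q.gaussSum 1 • (coreS Q Q' * Matrix.diagonal (coreT Q Q')) ^ 3 = 1 ↔
      Q.gaussSum 1 * Q'.gaussSum 1 = -1 := by
  have hlin : ∀ (c : ℂ) (w : Neutral G G' → ℂ), evenLeft (c • w) = c • evenLeft w := by
    intro c w
    funext g
    by_cases h : g = 0
    · subst h; simp [evenLeft_zero, mul_add]
    · simp [evenLeft_of_ne _ h]
  have hlin' : ∀ (c : ℂ) (w : Neutral G G' → ℂ), evenRight (c • w) = c • evenRight w := by
    intro c w
    funext g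
    by_cases h : g = 0
    · subst h; simp [evenRight_zero, mul_sub]
    · simp [evenRight_of_ne _ h]
  constructor
  · intro h
    -- This vector has right component 1 at 0, so the scalar by which the matrix acts on right
    -- components can be read off there.
    let v : Neutral G G' → ℂ := fun x => if x = .inr (.inl ()) then 1 else 0
    have h1 := evenRight_core_cube Q Q' hG hG' hc v
    have h2 : v = Q.gaussSum 1 •
        ((coreS Q Q' * Matrix.diagonal (coreT Q Q')) ^ 3).mulVec v := by
      rw [← Matrix.smul_mulVec, h, Matrix.one_mulVec]
    have h3 := congrFun (congrArg evenRight h2) (0 : G')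
    rw [hlin', h1] at h3
    simp [evenRight_zero, v] at h3
    linear_combination h3
  · intro h
    apply Matrix.mulVec_injective
    funext v
    rw [Matrix.one_mulVec, Matrix.smul_mulVec]
    apply eq_of_evenLeft_evenRight
    · rw [hlin, evenLeft_core_cube Q Q' hG, smul_smul, gaussSum_mul_conj, one_smul]
    · rw [hlin', evenRight_core_cube Q Q' hG hG' hc, smul_smul, mul_neg, h, neg_neg, one_smul]

end Intertwiners

/-! ### Fusion coefficients and unitarity of the core -/

section Verlinde

variable {G G' : Type*} [AddCommGroup G] [Fintype G] [AddCommGroup G'] [Fintype G']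
  [DecidableEq G] [DecidableEq G'] (Q : NondegQuadForm G) (Q' : NondegQuadForm G')

/-- The ratios between the rows of `coreS` and its first row on classes of `G`. -/
noncomputable def leftRow (x : Neutral G G') (z : NonzeroUpToSign G) : ℂ :=
  match x with
  | .inl _ => 1
  | .inr (.inl _) => 1
  | .inr (.inr (.inl y)) => signCos Q y z
  | .inr (.inr (.inr _)) => 0

/-- The ratios between the rows of `coreS` and its first row on classes of `G'`. -/
noncomputable def rightRow (x : Neutral G G') (z : NonzeroUpToSign G') : ℂ :=
  match x with
  | .inl _ => 1
  | .inr (.inl _) => -1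
  | .inr (.inr (.inl _)) => 0
  | .inr (.inr (.inr y)) => -signCos Q' y z

omit [DecidableEq G] [DecidableEq G'] in
theorem coreEntry_left (x : Neutral G G') (z : NonzeroUpToSign G) :
    coreEntry Q Q' x (.inr (.inr (.inl z))) =
      ((delta (Fintype.card G) : ℂ) + 2) * leftRow Q x z := by
  rcases x with _ | _ | x | x <;> simp [coreEntry, leftRow]

omit [DecidableEq G] [DecidableEq G'] in
theorem coreEntry_right (x : Neutral G G') (z : NonzeroUpToSign G') :
    coreEntry Q Q' x (.inr (.inr (.inr z))) =
      (delta (Fintype.card G) : ℂ) * rightRow Q' x z := by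
  rcases x with _ | _ | x | x <;> simp [coreEntry, rightRow]

/-- The row of the identity is constant on the classes of G (δ + 2) and on those of G' (δ). Each
such column therefore contributes the square of that constant times a product of row ratios. -/
theorem verlinde_sum_eq (hG : 0 < Fintype.card G) (x y z : Neutral G G') :
    ∑ d, coreS Q Q' x d * coreS Q Q' y d * coreS Q Q' z d / coreS Q Q' (.inl ()) d =
      (kap (Fintype.card G) : ℂ) ^ 2 *
      (coreEntry Q Q' x (.inl ()) * coreEntry Q Q' y (.inl ()) * coreEntry Q Q' z (.inl ()) +
      (coreEntry Q Q' x (.inr (.inl ())) * coreEntry Q Q' y (.inr (.inl ())) *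
        coreEntry Q Q' z (.inr (.inl ())) / ((delta (Fintype.card G) : ℂ) + 1) +
      (((delta (Fintype.card G) : ℂ) + 2) ^ 2 *
        ∑ w, leftRow Q x w * leftRow Q y w * leftRow Q z w +
      (delta (Fintype.card G) : ℂ) ^ 2 *
        ∑ w, rightRow Q' x w * rightRow Q' y w * rightRow Q' z w))) := by
  have hk : (kap (Fintype.card G) : ℂ) ≠ 0 := by exact_mod_cast (kap_pos hG).ne'
  have hd := delta_pos hG
  have hd0 : (delta (Fintype.card G) : ℂ) ≠ 0 := by exact_mod_cast hd.ne'
  have hd1 : (delta (Fintype.card G) : ℂ) + 1 ≠ 0 := by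
    exact_mod_cast (by linarith : (delta (Fintype.card G) + 1 : ℝ) ≠ 0)
  have hd2 : (delta (Fintype.card G) : ℂ) + 2 ≠ 0 := by
    exact_mod_cast (by linarith : (delta (Fintype.card G) + 2 : ℝ) ≠ 0)
  have key : ∀ d, coreS Q Q' x d * coreS Q Q' y d * coreS Q Q' z d / coreS Q Q' (.inl ()) d =
      (kap (Fintype.card G) : ℂ) ^ 2 * (coreEntry Q Q' x d * coreEntry Q Q' y d *
        coreEntry Q Q' z d / coreEntry Q Q' (.inl ()) d) := by
    intro d
    simp only [coreS, Matrix.of_apply]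
    rw [show ∀ k a b c : ℂ, k * a * (k * b) * (k * c) = k * (k ^ 2 * (a * b * c)) by
      intros; ring, mul_div_mul_left _ _ hk, mul_div_assoc]
  simp only [key, ← Finset.mul_sum, Fintype.sum_sum_type, Finset.univ_unique,
    Finset.sum_singleton, PUnit.default_eq_unit, coreEntry_left, coreEntry_right]
  congr 2
  · simp [coreEntry]
  congr 1
  rw [Finset.mul_sum, Finset.mul_sum]
  congr 1
  · refine Finset.sum_congr rfl fun w _ => ?_
    simp only [leftRow]
    field_simp
  · refine Finset.sum_congr rfl fun w _ => ?_
    simp only [rightRow]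
    field_simp

omit [Fintype G] [Fintype G'] [DecidableEq G] [DecidableEq G'] in
-- Symmetry of the Verlinde sum cuts the 64 combinations of kinds down to the 20 sorted ones.
theorem symmetric_of_sorted {P : Neutral G G' → Neutral G G' → Neutral G G' → Prop}
    (rank : Neutral G G' → ℕ) (h12 : ∀ x y z, P x y z → P y x z) (h23 : ∀ x y z, P x y z → P x z y)
    (h : ∀ x y z, rank x ≤ rank y → rank y ≤ rank z → P x y z) (x y z : Neutral G G') :
    P x y z := by
  rcases le_total (rank x) (rank y) with hxy | hxy <;>
  rcases le_total (rank y) (rank z) with hyz | hyz <;>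
  rcases le_total (rank x) (rank z) with hxz | hxz
  · exact h _ _ _ hxy hyz
  · exact h _ _ _ hxy hyz
  · exact h23 _ _ _ (h _ _ _ hxz hyz)
  · exact h23 _ _ _ (h12 _ _ _ (h _ _ _ hxz hxy))
  · exact h12 _ _ _ (h _ _ _ hxy hxz)
  · exact h12 _ _ _ (h23 _ _ _ (h _ _ _ hyz hxz))
  · exact h12 _ _ _ (h23 _ _ _ (h12 _ _ _ (h _ _ _ hyz hxy)))
  · exact h12 _ _ _ (h23 _ _ _ (h12 _ _ _ (h _ _ _ hyz hxy)))

/-- The kind of a class. -/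
def Neutral.rank : Neutral G G' → ℕ
  | .inl _ => 0
  | .inr (.inl _) => 1
  | .inr (.inr (.inl _)) => 2
  | .inr (.inr (.inr _)) => 3

theorem verlinde_sum_of_sorted (hG : Odd (Fintype.card G)) (hG' : Odd (Fintype.card G'))
    (hc : Fintype.card G' = Fintype.card G + 4) (x y z : Neutral G G')
    (hxy : x.rank ≤ y.rank) (hyz : y.rank ≤ z.rank) :
    ∃ N : ℕ, ∑ d, coreS Q Q' x d * coreS Q Q' y d * coreS Q Q' z d / coreS Q Q' (.inl ()) d =
      (N : ℂ) := by
  have hd := delta_pos hG.pos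
  have hsq := congrArg Complex.ofReal (delta_sq (Fintype.card G))
  have hk2 := congrArg Complex.ofReal (kap_mul_delta_add_two hG.pos)
  have hnn : (Real.sqrt (Fintype.card G) : ℂ) * Real.sqrt (Fintype.card G) = Fintype.card G :=
    sqrt_card_mul_self
  have hs0 : (Real.sqrt (Fintype.card G) : ℂ) ≠ 0 := sqrt_card_ne_zero
  have hd0 : (delta (Fintype.card G) : ℂ) ≠ 0 := by exact_mod_cast hd.ne'
  have hd1 : (delta (Fintype.card G) : ℂ) + 1 ≠ 0 := by
    exact_mod_cast (by linarith : (delta (Fintype.card G) + 1 : ℝ) ≠ 0)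
  have hd2 : (delta (Fintype.card G) : ℂ) + 2 ≠ 0 := by
    exact_mod_cast (by linarith : (delta (Fintype.card G) + 2 : ℝ) ≠ 0)
  have hl : (2 * Fintype.card (NonzeroUpToSign G) + 1 : ℂ) = Fintype.card G := by
    exact_mod_cast two_mul_card_nonzeroUpToSign hG
  have hr : (2 * Fintype.card (NonzeroUpToSign G') + 1 : ℂ) = Fintype.card G + 4 := by
    exact_mod_cast (two_mul_card_nonzeroUpToSign hG').trans hc
  have hcn : (Fintype.card G' : ℂ) = Fintype.card G + 4 := by exact_mod_cast hc
  push_cast at hsq hk2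
  rw [verlinde_sum_eq Q Q' hG.pos]
  -- The order n, the squared normalization and the numbers of classes all become rational functions
  -- of δ, so every case below is an identity of rational functions in δ (and N).
  have hn : (Fintype.card G : ℂ) = (delta (Fintype.card G) : ℂ) ^ 2 /
      ((delta (Fintype.card G) : ℂ) + 1) := by rw [eq_div_iff hd1, hsq]
  have hkap : (kap (Fintype.card G) : ℂ) ^ 2 = ((delta (Fintype.card G) : ℂ) + 1) /
      ((delta (Fintype.card G) : ℂ) ^ 2 * ((delta (Fintype.card G) : ℂ) + 2) ^ 2) := by
    have h1 : (kap (Fintype.card G) : ℂ) ^ 2 * (((delta (Fintype.card G) : ℂ) + 2) ^ 2) *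
        Fintype.card G = 1 := by
      rw [← mul_pow, hk2, ← hnn]
      field_simp
    rw [eq_div_iff (by positivity)]
    rw [hsq]
    linear_combination ((delta (Fintype.card G) : ℂ) + 1) * h1
  have hl' : (Fintype.card (NonzeroUpToSign G) : ℂ) = ((delta (Fintype.card G) : ℂ) ^ 2 /
      ((delta (Fintype.card G) : ℂ) + 1) - 1) / 2 := by rw [← hn, ← hl]; ring
  have hr' : (Fintype.card (NonzeroUpToSign G') : ℂ) = ((delta (Fintype.card G) : ℂ) ^ 2 /
      ((delta (Fintype.card G) : ℂ) + 1) + 3) / 2 := by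
    rw [← hn]; linear_combination hr / 2
  rw [hkap]
  clear hkap hsq hk2 hnn hs0 hl hr
  have hSl := fun x => sum_signCos Q hG x
  have hSr := fun x => sum_signCos Q' hG' x
  rw [hn] at hcn
  have hPl := fun x y => sum_signCos_mul Q hG x y
  have hPr := fun x y => sum_signCos_mul Q' hG' x y
  have hTl := fun x y z => sum_signCos_mul_mul Q hG x y z
  have hTr := fun x y z => sum_signCos_mul_mul Q' hG' x y z
  rw [hn] at hPl hTl
  rw [hcn] at hPr hTr
  clear hcn hn
  rcases x with _ | _ | x | x <;> rcases y with _ | _ | y | y <;> rcases z with _ | _ | z | z <;>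
    first
    | (exfalso; revert hxy hyz; simp [Neutral.rank]; done)
    | skip
  all_goals
    simp only [coreEntry, leftRow, rightRow, mul_one, one_mul, mul_zero, zero_mul, mul_neg,
      neg_mul, neg_neg, Finset.sum_const, Finset.sum_neg_distrib, Finset.card_univ, nsmul_eq_mul,
      neg_zero, hSl, hSr, hl', hr']
  · exact ⟨1, by push_cast; field_simp; ring⟩
  · exact ⟨0, by push_cast; field_simp; ring⟩
  · exact ⟨0, by push_cast; field_simp; ring⟩
  · exact ⟨0, by push_cast; field_simp; ring⟩
  · exact ⟨1, by push_cast; field_simp; ring⟩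
  · exact ⟨0, by push_cast; field_simp; ring⟩
  · exact ⟨0, by push_cast; field_simp; ring⟩
  · obtain ⟨N, hN, hs⟩ := hPl y z
    exact ⟨N, by rw [hs]; field_simp; ring⟩
  · exact ⟨0, by push_cast; field_simp; ring⟩
  · obtain ⟨N, hN, hs⟩ := hPr y z
    exact ⟨N, by rw [hs]; field_simp; ring⟩
  · exact ⟨1, by push_cast; field_simp; ring⟩
  · exact ⟨1, by push_cast; field_simp; ring⟩
  · exact ⟨1, by push_cast; field_simp; ring⟩
  · obtain ⟨N, hN, hs⟩ := hPl y z
    exact ⟨1 + N, by rw [hs]; push_cast; field_simp; ring⟩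
  · exact ⟨1, by push_cast; field_simp; ring⟩
  · obtain ⟨N, hN, hs⟩ := hPr y z
    -- The bound N ≤ 1 makes the natural-number subtraction a genuine one.
    exact ⟨1 - N, by rw [hs, Nat.cast_sub hN]; push_cast; field_simp; ring⟩
  · obtain ⟨N, hN, hs⟩ := hTl x y z
    exact ⟨1 + N, by rw [hs]; push_cast; field_simp; ring⟩
  · exact ⟨1, by push_cast; field_simp; ring⟩
  · exact ⟨1, by push_cast; field_simp; ring⟩
  · obtain ⟨N, hN, hs⟩ := hTr x y z
    exact ⟨1 - N, by rw [hs, Nat.cast_sub hN]; push_cast; field_simp; ring⟩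

theorem coreS_isIdentityFor (hG : Odd (Fintype.card G)) (hG' : Odd (Fintype.card G'))
    (hc : Fintype.card G' = Fintype.card G + 4) :
    IsIdentityFor (coreS Q Q') (.inl ()) := by
  constructor
  · have hd := delta_pos hG.pos
    have hk := kap_pos hG.pos
    rintro (_ | _ | x | x)
    · exact ⟨(kap (Fintype.card G)) ^ 2, by positivity, by simp [coreS, coreEntry]⟩
    · exact ⟨(kap (Fintype.card G) * (delta (Fintype.card G) + 1)) ^ 2, by positivity,
        by simp [coreS, coreEntry]⟩
    · exact ⟨(kap (Fintype.card G) * (delta (Fintype.card G) + 2)) ^ 2, by positivity,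
        by simp [coreS, coreEntry]⟩
    · exact ⟨(kap (Fintype.card G) * delta (Fintype.card G)) ^ 2, by positivity,
        by simp [coreS, coreEntry]⟩
  · refine symmetric_of_sorted Neutral.rank (fun x y z h => ?_) (fun x y z h => ?_)
      (verlinde_sum_of_sorted Q Q' hG hG' hc)
    · simpa only [mul_comm (coreS Q Q' y _)] using h
    · simpa only [mul_right_comm _ (coreS Q Q' z _)] using h

omit [DecidableEq G] [DecidableEq G'] in
theorem coreS_isSymm : (coreS Q Q').IsSymm := by
  ext x y
  simp only [Matrix.transpose_apply, coreS, Matrix.of_apply]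
  rcases x with _ | _ | x | x <;> rcases y with _ | _ | y | y <;>
    simp only [coreEntry]
  · rw [signCos_comm]
  · rw [signCos_comm]

theorem signCos_conj {A : Type*} [AddCommGroup A] [Fintype A] (P : NondegQuadForm A)
    (x y : NonzeroUpToSign A) : conj (signCos P x y) = signCos P x y := by
  obtain ⟨p, hp, rfl⟩ := nzMk_surj x
  obtain ⟨q, hq, rfl⟩ := nzMk_surj y
  rw [signCos_mk, NondegQuadForm.cosPairing, map_add, map_pow, map_pow, Complex.conj_conj, add_comm]

/-- The core is a real symmetric involution. -/
theorem coreS_mem_unitaryGroup (hG : Odd (Fintype.card G)) (hG' : Odd (Fintype.card G'))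
    (hc : Fintype.card G' = Fintype.card G + 4) :
    coreS Q Q' ∈ Matrix.unitaryGroup (Neutral G G') ℂ := by
  have h : star (coreS Q Q') = coreS Q Q' := by
    ext x y
    rw [Matrix.star_apply, ← (coreS_isSymm Q Q').apply]
    simp only [coreS, Matrix.of_apply]
    rcases x with _ | _ | x | x <;> rcases y with _ | _ | y | y <;>
      simp [coreEntry, signCos_conj]
  rw [Matrix.mem_unitaryGroup_iff, h, coreS_mul_self Q Q' hG hG' hc]

omit [DecidableEq G] [DecidableEq G'] in
theorem isOfFinOrder_coreT (hG : Odd (Fintype.card G)) (hG' : Odd (Fintype.card G'))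
    (x : Neutral G G') : IsOfFinOrder (coreT Q Q' x) := by
  rcases x with _ | _ | x | x
  · exact IsOfFinOrder.one
  · exact IsOfFinOrder.one
  · obtain ⟨p, hp, rfl⟩ := nzMk_surj x
    rw [coreT, signTwist_mk Q hG, ← qzExp_neg]
    exact isOfFinOrder_qzExp _
  · obtain ⟨p, hp, rfl⟩ := nzMk_surj x
    rw [coreT, signTwist_mk Q' hG']
    exact isOfFinOrder_qzExp _

/-! ### The modular data attached to two forms -/

theorem kronecker_isModularData_iff (hG : Odd (Fintype.card G)) (hG' : Odd (Fintype.card G'))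
    (hc : Fintype.card G' = Fintype.card G + 4) :
    IsModularData (weilS Q 1 ⊗ₖ coreS Q Q') (weilT Q 1 ⊗ₖ Matrix.diagonal (coreT Q Q')) ↔
      Q.gaussSum 1 * Q'.gaussSum 1 = -1 := by
  have hcore := coreS_mul_self Q Q' hG hG' hc
  have hS2 : (weilS Q 1 ⊗ₖ coreS Q Q') ^ 2 = (weilS Q 1 ^ 2) ⊗ₖ 1 := by
    rw [pow_two, ← Matrix.mul_kronecker_mul, hcore, pow_two]
  have hST : ((weilS Q 1 ⊗ₖ coreS Q Q') * (weilT Q 1 ⊗ₖ Matrix.diagonal (coreT Q Q'))) ^ 3 =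
      (weilS Q 1 ^ 2) ⊗ₖ
        (Q.gaussSum 1 • (coreS Q Q' * Matrix.diagonal (coreT Q Q')) ^ 3) := by
    have h := weil_cube Q 1 1
    rw [one_pow, one_mul, one_mul] at h
    rw [Matrix.kronecker_smul, ← Matrix.smul_kronecker, ← h, ← Matrix.mul_kronecker_mul]
    simp only [pow_succ, pow_zero, one_mul, ← Matrix.mul_kronecker_mul]
  rw [← smul_core_cube_eq_one_iff Q Q' hG hG' hc]
  have hTd : weilT Q 1 ⊗ₖ Matrix.diagonal (coreT Q Q') = Matrix.diagonal
      (fun p : G × Neutral G G' => 1 * qzExp (Q.toFun p.1) * coreT Q Q' p.2) :=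
    Matrix.diagonal_kronecker_diagonal _ _
  have hTf : ∀ p : G × Neutral G G',
      IsOfFinOrder (1 * qzExp (Q.toFun p.1) * coreT Q Q' p.2) := fun p =>
    (IsOfFinOrder.one.mul (isOfFinOrder_qzExp _)).mul (isOfFinOrder_coreT Q Q' hG hG' p.2)
  constructor
  · intro h
    have h3 := ((exists_hom_iff _ _).1 h.rep).2
    rw [hS2, hST] at h3
    ext x y
    -- The (0, 0) entry of the squared Weil matrix is 1, so this block isolates the identity for the
    -- core.
    have h4 := congrFun (congrFun h3 (0, x)) (0, y)
    rw [Matrix.kronecker_apply, Matrix.kronecker_apply, pow_two, weilS_mul_self] at h4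
    simpa using h4
  · intro h
    refine ⟨Matrix.kronecker_mem_unitary (weilS_mem_unitaryGroup Q (Or.inl rfl))
      (coreS_mem_unitaryGroup Q Q' hG hG' hc), ?_, ?_, ?_, ?_, (exists_hom_iff _ _).2 ⟨?_, ?_⟩,
      (0, .inl ()), (weilS_isIdentityFor Q (Or.inl rfl)).kronecker
        (coreS_isIdentityFor Q Q' hG hG' hc)⟩
    · rw [hTd]; exact diagonal_mem_unitaryGroup hTf
    · ext ⟨a, x⟩ ⟨b, y⟩
      rw [Matrix.transpose_apply, Matrix.kronecker_apply, Matrix.kronecker_apply,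
        (weilS_isSymm Q 1).apply, (coreS_isSymm Q Q').apply]
    · rw [hTd]; exact Matrix.isDiag_diagonal _
    · rw [hTd]; exact isOfFinOrder_diagonal hTf
    · rw [show 4 = 2 * 2 from rfl, pow_mul, hS2, pow_two, ← Matrix.mul_kronecker_mul, ← pow_add,
        weilS_pow_four, one_pow, one_smul, mul_one, Matrix.one_kronecker_one]
    · rw [hST, h, hS2]

theorem kronecker_identity_unique (hG : Odd (Fintype.card G)) (hG' : Odd (Fintype.card G'))
    (hc : Fintype.card G' = Fintype.card G + 4) (e : G × Neutral G G') :
    (IsIdentityFor (weilS Q 1 ⊗ₖ coreS Q Q') e ∧ HasPosDims (weilS Q 1 ⊗ₖ coreS Q Q') e) ↔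
      e = (0, .inl ()) := by
  have hd := delta_pos hG.pos
  have hk := kap_pos hG.pos
  have hk0 : (kap (Fintype.card G) : ℂ) ≠ 0 := by exact_mod_cast hk.ne'
  have h0 := sqrt_card_ne_zero (G := G)
  have hw : ∀ g h, weilS Q 1 g h ≠ 0 := fun g h =>
    mul_ne_zero (div_ne_zero one_ne_zero h0)
      (right_ne_zero_of_mul_eq_one (Q.pairing_mul_conj g h))
  have hent : ∀ (m : G) (x y : Neutral G G'), (weilS Q 1 ⊗ₖ coreS Q Q') (m, x) (m, y) /
      (weilS Q 1 ⊗ₖ coreS Q Q') (m, y) (m, y) = coreEntry Q Q' x y / coreEntry Q Q' y y := by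
    intro m x y
    rw [Matrix.kronecker_apply, Matrix.kronecker_apply, mul_div_mul_left _ _ (hw m m), coreS,
      Matrix.of_apply, Matrix.of_apply, mul_div_mul_left _ _ hk0]
  constructor
  · rintro ⟨-, he⟩
    obtain ⟨m, x⟩ := e
    have hpos : ∀ y : Neutral G G', ∃ r : ℝ, 0 < r ∧
        coreEntry Q Q' y x / coreEntry Q Q' x x = (r : ℂ) := fun y => by
      rw [← hent m]; exact he (m, y)
    -- All entries of the column are positive multiples of the diagonal entry, so any two real ones
    -- have the same sign and neither vanishes.
    have key : ∀ (y z : Neutral G G') (a b : ℝ), coreEntry Q Q' y x = a →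
        coreEntry Q Q' z x = b → 0 < a * b := by
      intro y z a b ha hb
      obtain ⟨r, hr, h1⟩ := hpos y
      obtain ⟨s, hs, h2⟩ := hpos z
      have hne : coreEntry Q Q' x x ≠ 0 := by
        intro h
        rw [h, div_zero] at h1
        exact hr.ne (by exact_mod_cast h1)
      rw [div_eq_iff hne, ha] at h1
      rw [div_eq_iff hne, hb] at h2
      have h3 : a * s = b * r := by
        have : (a : ℂ) * s = b * r := by rw [h1, h2]; ring
        exact_mod_cast this
      have ha0 : a ≠ 0 := by
        rintro rfl
        rw [Complex.ofReal_zero] at h1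
        rcases mul_eq_zero.1 h1.symm with h | h
        · exact hr.ne' (by exact_mod_cast h)
        · exact hne h
      have h4 : a * b * r = a ^ 2 * s := by rw [mul_assoc, ← h3]; ring
      have h5 : 0 < a ^ 2 * s := by positivity
      rw [← h4] at h5
      exact pos_of_mul_pos_left h5 hr.le
    obtain ⟨γ, hγ⟩ : ∃ γ : G', γ ≠ 0 := by
      have : 1 < Fintype.card G' := by omega
      exact Fintype.exists_ne_of_one_lt_card this 0
    -- Only the first column survives: the second contains δ + 1 and -δ, those of G contain a 0, and
    -- those of G' contain δ and -δ.
    rcases x with _ | _ | x | x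
    · have hm : m = 0 := by
        refine Q.eq_zero_of_conj_pairing_pos fun g => ?_
        obtain ⟨r, hr, h⟩ := he (g, .inl ())
        refine ⟨r, hr, ?_⟩
        rw [← h, Matrix.kronecker_apply, Matrix.kronecker_apply, mul_div_mul_right, weilS,
          Matrix.of_apply, Matrix.of_apply, mul_div_mul_left _ _ (div_ne_zero one_ne_zero h0)]
        simpa [coreS, coreEntry] using hk.ne'
      rw [hm]
    · have := key (.inl ()) (.inr (.inr (.inr (nzMk γ hγ)))) (delta (Fintype.card G) + 1)
        (-delta (Fintype.card G)) (by simp [coreEntry]) (by simp [coreEntry])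
      nlinarith
    · have := key (.inl ()) (.inr (.inr (.inr (nzMk γ hγ)))) (delta (Fintype.card G) + 2)
        0 (by simp [coreEntry]) (by simp [coreEntry])
      simp at this
    · have := key (.inl ()) (.inr (.inl ())) (delta (Fintype.card G))
        (-delta (Fintype.card G)) (by simp [coreEntry]) (by simp [coreEntry])
      nlinarith
  · rintro rfl
    refine ⟨(weilS_isIdentityFor Q (Or.inl rfl)).kronecker (coreS_isIdentityFor Q Q' hG hG' hc),
      ?_⟩
    rintro ⟨m, x⟩
    have h : (weilS Q 1 ⊗ₖ coreS Q Q') (m, x) (0, .inl ()) /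
        (weilS Q 1 ⊗ₖ coreS Q Q') (0, .inl ()) (0, .inl ()) = coreEntry Q Q' x (.inl ()) := by
      have h1 := hent 0 x (.inl ())
      rw [show coreEntry Q Q' (.inl ()) (.inl ()) = 1 from rfl, div_one] at h1
      rw [← h1, Matrix.kronecker_apply, Matrix.kronecker_apply, Matrix.kronecker_apply,
        weilS_zero_right, weilS_zero_right]
    rw [h]
    rcases x with _ | _ | x | x
    · exact ⟨1, one_pos, by simp [coreEntry]⟩
    · exact ⟨delta (Fintype.card G) + 1, by positivity, by simp [coreEntry]⟩
    · exact ⟨delta (Fintype.card G) + 2, by positivity, by simp [coreEntry]⟩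
    · exact ⟨delta (Fintype.card G), hd, by simp [coreEntry]⟩

end Verlinde

end NearGroup

theorem proposition7 :
    (∀ (G : Type*) [AddCommGroup G] [Fintype G] [DecidableEq G] (Q : NearGroup.NondegQuadForm G)
        (α β : ℂ),
      (NearGroup.IsModularData (NearGroup.weilS Q α) (NearGroup.weilT Q β) ↔
        (α = 1 ∨ α = -1) ∧ β ^ 3 = α * Q.gaussSum (-1)) ∧
      (NearGroup.IsModularData (NearGroup.weilS Q α) (NearGroup.weilT Q β) →
        ∀ e : G, (NearGroup.IsIdentityFor (NearGroup.weilS Q α) e ∧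
          NearGroup.HasPosDims (NearGroup.weilS Q α) e) ↔ e = 0)) ∧
    (∀ (G G' : Type*) [AddCommGroup G] [Fintype G] [DecidableEq G]
        [AddCommGroup G'] [Fintype G'] [DecidableEq G']
        (n : ℕ), Odd n → Fintype.card G = n → Fintype.card G' = n + 4 →
      ∀ (Q : NearGroup.NondegQuadForm G) (Q' : NearGroup.NondegQuadForm G'),
      Fintype.card (NearGroup.Primary G G') = n * (n + 3) ∧
      (NearGroup.IsModularData (NearGroup.doubleS Q Q') (NearGroup.doubleT Q Q') ↔
        Q.gaussSum 1 * Q'.gaussSum 1 = -1) ∧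
      (NearGroup.IsModularData (NearGroup.doubleS Q Q') (NearGroup.doubleT Q Q') →
        ∀ e : NearGroup.Primary G G', (NearGroup.IsIdentityFor (NearGroup.doubleS Q Q') e ∧
          NearGroup.HasPosDims (NearGroup.doubleS Q Q') e) ↔ e = NearGroup.Primary.a G' 0)) := by
  refine ⟨fun G _ _ _ Q α β => ⟨NearGroup.weil_isModularData_iff Q α β,
    NearGroup.weil_identity_unique Q⟩, ?_⟩
  rintro G G' _ _ _ _ _ _ n hn rfl hc Q Q'
  have hG' : Odd (Fintype.card G') := by rw [hc]; exact hn.add_even (by decide)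
  refine ⟨NearGroup.card_primary hn rfl hc, ?_, fun _ e => ?_⟩
  · rw [← NearGroup.isModularData_submatrix_iff (NearGroup.primaryEquiv G' hn),
      NearGroup.doubleS_submatrix, NearGroup.doubleT_submatrix,
      NearGroup.kronecker_isModularData_iff Q Q' hn hG' hc]
  · obtain ⟨e, rfl⟩ := (NearGroup.primaryEquiv G' hn).surjective e
    rw [← NearGroup.isIdentityFor_submatrix_iff, ← NearGroup.hasPosDims_submatrix_iff,
      NearGroup.doubleS_submatrix, NearGroup.kronecker_identity_unique Q Q' hn hG' hc,
      ← (NearGroup.primaryEquiv G' hn).apply_eq_iff_eq]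
    rfl
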